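/- Let $(\phi_j)_{j\ge1}$ be an orthonormal system in the real space $L_2(0,1)$. For $\varepsilon>0$ a signal $S\in L_2(0,1)$ is observed in Gaussian white noise, $dY_\varepsilon(t)=S(t)\,dt+\varepsilon\,dw(t)$, through the coefficients $y_j=\theta_j+\varepsilon\xi_j$, $j\ge 1$, where $\theta_j=\int_0^1 S\phi_j\,dt$ and $\xi_j$ are independent standard normal variables. For given real $\varkappa_{\varepsilon j}$ with $\rho_\varepsilon^2=\sum_j\varkappa_{\varepsilon j}^2<\infty$ put $$T_\varepsilon=\varepsilon^{-2}\sum_{j}\varkappa_{\varepsilon j}^2y_j^2-\rho_\varepsilon^2,\qquad A_\varepsilon=\varepsilon^{-4}\sum_j\varkappa_{\varepsilon j}^4,\qquad B_\varepsilon(S)=\frac{\varepsilon^{-4}\sum_j\varkappa_{\varepsilon j}^2\theta_j^2}{(2A_\varepsilon)^{1/2}},$$ $k_\varepsilon=\sup\{k\ge1:\sum_{j<k}\varkappa_{\varepsilon j}^2\le\frac12\rho_\varepsilon^2\}$ and $\varkappa_\varepsilon^2=\varkappa_{\varepsilon k_\varepsilon}^2$. The test $L_\varepsilon$ with threshold $x_\varepsilon\in\mathbb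 R$ rejects the hypothesis $S=0$ when $\varepsilon^{-2}(2A_\varepsilon)^{-1/2}T_\varepsilon>x_\varepsilon$; $\alpha(L_\varepsilon)$ is its type I error probability (at $S=0$) and $\beta(L_\varepsilon,S)$ its type II error probability at the alternative $S$. Only tests of this form, with $0<\alpha(L_\varepsilon)<1$ for all small $\varepsilon$, are considered. Throughout, $a_\varepsilon\asymp b_\varepsilon$ means that $a_\varepsilon/b_\varepsilon$ lies between two positive constants for all small $\varepsilon>0$. Assume: A1. For each $\varepsilon>0$ the sequence $(\varkappa_{\varepsilon j}^2)_j$ is non-increasing. A2. $C_1<A_\varepsilon<C_2$ for all $\varepsilon>0$, with constants $0<C_1<C_2$. A3. There are $C>0$ and $\lambda>1$ such that $\varkappa^2_{\varepsilon,[(1+\delta)k_\varepsilon]}<C(1+\delta)^{-\lambda}\varkappa_\varepsilon^2$ for all $\delta>0$, $\varepsilon>0$. A4. $\varkappa_{\varepsilon1}^2\asymp\varkappa_\varepsilon^2$; and for every $c>1$ there is $C>0$ with $\varkappa^2_{\varepsilon,[ck_\varepsilon]}\ge C\varkappa_\varepsilon^2$ for all $\varepsilon>0$. Let $0<r<1/2$,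 $0<2\omega<1-2r$ and $k_\varepsilon\asymp\varepsilon^{-4+8r+4\omega}$. A family $S_\varepsilon$ is called $\varepsilon^{-2\omega}$-LD consistent if for all tests $L_\varepsilon$ with $\varepsilon^{4\omega}\log\alpha(L_\varepsilon)\to0$ as $\varepsilon\to0$ there is $c>0$ with $|\log\beta(L_\varepsilon,S_\varepsilon)|\ge c\,\varepsilon^{-4\omega}$ for all small $\varepsilon$; consistency along a sequence $\varepsilon_n\to0$ is defined in the same way, with $\varepsilon$ restricted to the sequence. The family is called $\varepsilon^{-2\omega}$-LD inconsistent if it is not consistent along any sequence $\varepsilon_n\to0$, $\varepsilon_n>0$. **Theorem.** Let $S_\varepsilon$ be $\varepsilon^{-2\omega}$-LD consistent and $S_{1\varepsilon}$ be $\varepsilon^{-2\omega}$-LD inconsistent, $\|S_\varepsilon\|\asymp\varepsilon^{2r}$, $\|S_{1\varepsilon}\|\asymp\varepsilon^{2r}$. Then for all tests $L_\varepsilon$ (with $0<\alpha(L_\varepsilon)<1$ for small $\varepsilon$) such that either $\varepsilon^{4\omega}\log\alpha(L_\varepsilon)\to0$, or $B_\varepsilon(S_\varepsilon)-x_\varepsilon\ge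 c\,B_\varepsilon(S_\varepsilon)$ for some $c>0$ and all small $\varepsilon$, $$\lim_{\varepsilon\to0}\frac{\log\beta(L_\varepsilon,S_\varepsilon)-\log\beta(L_\varepsilon,S_\varepsilon+S_{1\varepsilon})}{\log\beta(L_\varepsilon,S_\varepsilon)}=0 .$$ -/

import Mathlib

open Filter Topology MeasureTheory ProbabilityTheory Asymptotics

namespace SignalDetection

/-- The real Hilbert space `L₂(0,1)` of signals. -/
abbrev Signal : Type := Lp ℝ 2 (volume.restrict (Set.Ioo (0 : ℝ) 1))

/-- Fourier coefficients `θ_j = ∫₀¹ S φ_j dt`. All sequences in this file start at index `0`: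
index `i` stands for `j = i + 1`. -/
noncomputable def fourierCoef (φ : ℕ → Signal) (S : Signal) (i : ℕ) : ℝ :=
  inner ℝ (φ i) S

/-- Law of the observed coefficients `y_j = θ_j + ε ξ_j`, `ξ_j` i.i.d. standard normal, of the
signal `S` in Gaussian white noise of intensity `ε`, i.e. `y_j = ∫ φ_j dY` for
`dY(t) = S(t) dt + ε dw(t)`. -/
noncomputable def observationLaw (φ : ℕ → Signal) (ε : ℝ) (S : Signal) : Measure (ℕ → ℝ) :=
  Measure.infinitePi fun i => gaussianReal (fourierCoef φ S i) (Real.toNNReal (ε ^ 2))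

/-- `ρ_ε² = ∑_j ϰ_{εj}²`. -/
noncomputable def rhoSq (κ : ℝ → ℕ → ℝ) (ε : ℝ) : ℝ := ∑' i, κ ε i ^ 2

/-- `A_ε = ε⁻⁴ ∑_j ϰ_{εj}⁴`. -/
noncomputable def ACoef (κ : ℝ → ℕ → ℝ) (ε : ℝ) : ℝ := (ε ^ 4)⁻¹ * ∑' i, κ ε i ^ 4

/-- `k_ε = sup {k : ∑_{j < k} ϰ_{εj}² ≤ ρ_ε² / 2}` (`k` ranges over the positive integers; the
indices `1 ≤ j < k` are `0 ≤ i < k - 1`). -/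
noncomputable def kIndex (κ : ℝ → ℕ → ℝ) (ε : ℝ) : ℕ :=
  sSup {k : ℕ | 1 ≤ k ∧ ∑ i ∈ Finset.range (k - 1), κ ε i ^ 2 ≤ rhoSq κ ε / 2}

/-- The coefficient `ϰ_{ε,n}²` with the index `n ≥ 1` counted from one. -/
def kSqAt (κ : ℝ → ℕ → ℝ) (ε : ℝ) (n : ℕ) : ℝ := κ ε (n - 1) ^ 2

/-- `ϰ_ε² = ϰ_{ε,k_ε}²`. -/
noncomputable def kSq (κ : ℝ → ℕ → ℝ) (ε : ℝ) : ℝ := kSqAt κ ε (kIndex κ ε)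

/-- The conditions A1, A2, A3, A4 on the coefficients `ϰ_{εj}²` (and `ρ_ε² < ∞`). -/
structure WeightConditions (κ : ℝ → ℕ → ℝ) : Prop where
  summable : ∀ ε > 0, Summable fun i => κ ε i ^ 2
  A1 : ∀ ε > 0, Antitone fun i => κ ε i ^ 2
  A2 : ∃ C₁ > 0, ∃ C₂, ∀ ε > 0, C₁ < ACoef κ ε ∧ ACoef κ ε < C₂
  A3 : ∃ C₁ > 0, ∃ lam > (1 : ℝ), ∀ δ > (0 : ℝ), ∀ ε > 0,
    kSqAt κ ε ⌊(1 + δ) * kIndex κ ε⌋₊ < C₁ * (1 + δ) ^ (-lam) * kSq κ ε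
  A4_first : (fun ε => kSqAt κ ε 1) =Θ[𝓝[>] 0] (kSq κ)
  A4_tail : ∀ c > (1 : ℝ), ∃ C > 0, ∀ ε > 0, C * kSq κ ε ≤ kSqAt κ ε ⌊c * kIndex κ ε⌋₊

/-- The test statistic `T_ε = ε⁻² ∑_j ϰ_{εj}² y_j² - ρ_ε²`. -/
noncomputable def testStat (κ : ℝ → ℕ → ℝ) (ε : ℝ) (y : ℕ → ℝ) : ℝ :=
  (ε ^ 2)⁻¹ * ∑' i, κ ε i ^ 2 * y i ^ 2 - rhoSq κ ε

/-- Rejection region of the test `L_ε` with threshold `x`. Under the hypothesis, `ε⁻² T_ε` has mean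
`0` and variance `2 A_ε`, so that `x` is on the standard normal scale. -/
def rejectionRegion (κ : ℝ → ℕ → ℝ) (ε x : ℝ) : Set (ℕ → ℝ) :=
  {y | x < (ε ^ 2)⁻¹ * testStat κ ε y / √(2 * ACoef κ ε)}

/-- Type I error probability `α(L_ε)` of the test with threshold `x`. -/
noncomputable def typeI (φ : ℕ → Signal) (κ : ℝ → ℕ → ℝ) (ε x : ℝ) : ℝ :=
  (observationLaw φ ε 0).real (rejectionRegion κ ε x)

/-- Type II error probability `β(L_ε, S)` of the test with threshold `x`. -/
noncomputable def typeII (φ : ℕ → Signal) (κ : ℝ → ℕ → ℝ) (ε x : ℝ) (S : Signal) : ℝ :=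
  (observationLaw φ ε S).real (rejectionRegion κ ε x)ᶜ

/-- `D_ε(S) = ε⁻⁴ ∑_j ϰ_{εj}² θ_j²`. -/
noncomputable def DCoef (φ : ℕ → Signal) (κ : ℝ → ℕ → ℝ) (ε : ℝ) (S : Signal) : ℝ :=
  (ε ^ 4)⁻¹ * ∑' i, κ ε i ^ 2 * fourierCoef φ S i ^ 2

/-- `B_ε(S) = D_ε(S) / (2 A_ε)^{1/2}`. -/
noncomputable def BCoef (φ : ℕ → Signal) (κ : ℝ → ℕ → ℝ) (ε : ℝ) (S : Signal) : ℝ :=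
  DCoef φ κ ε S / √(2 * ACoef κ ε)

/-- The tests `L_ε` with thresholds `x ε` have type I error probabilities `α(L_ε) ∈ (0,1)`
as `ε` runs along `l`. -/
def IsTestFamily (φ : ℕ → Signal) (κ : ℝ → ℕ → ℝ) (l : Filter ℝ) (x : ℝ → ℝ) : Prop :=
  ∀ᶠ ε in l, 0 < typeI φ κ ε (x ε) ∧ typeI φ κ ε (x ε) < 1

/-- `r_ε⁻² log α(L_ε) → 0` as `ε` runs along `l`. -/
def LogLevelNegligible (φ : ℕ → Signal) (κ : ℝ → ℕ → ℝ) (l : Filter ℝ) (rate x : ℝ → ℝ) : Prop :=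
  Tendsto (fun ε => (rate ε ^ 2)⁻¹ * Real.log (typeI φ κ ε (x ε))) l (𝓝 0)

/-- `r_ε`-LD consistency of the alternatives `S_ε` as `ε` runs along `l`: for all tests `L_ε` based
on `T_ε` with `r_ε⁻² log α(L_ε) → 0` one has `|log β(L_ε, S_ε)| = Ω(r_ε²)`. -/
def LDConsistentAlong (φ : ℕ → Signal) (κ : ℝ → ℕ → ℝ) (l : Filter ℝ) (rate : ℝ → ℝ)
    (S : ℝ → Signal) : Prop :=
  ∀ x : ℝ → ℝ, IsTestFamily φ κ l x → LogLevelNegligible φ κ l rate x →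
    ∃ c > 0, ∀ᶠ ε in l, c * rate ε ^ 2 ≤ |Real.log (typeII φ κ ε (x ε) (S ε))|

/-- `r_ε`-LD consistency of the family `S_ε`, as `ε → 0`, `ε > 0`. -/
def LDConsistent (φ : ℕ → Signal) (κ : ℝ → ℕ → ℝ) (rate : ℝ → ℝ) (S : ℝ → Signal) : Prop :=
  LDConsistentAlong φ κ (𝓝[>] 0) rate S

/-- `r_ε`-LD inconsistency of the family `S_ε`, as `ε → 0`: along no sequence `ε_n → 0`, `ε_n > 0`,
are the alternatives `S_{ε_n}` consistent. -/
def LDInconsistent (φ : ℕ → Signal) (κ : ℝ → ℕ → ℝ) (rate : ℝ → ℝ) (S : ℝ → Signal) : Prop :=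
  ∀ u : ℕ → ℝ, Tendsto u atTop (𝓝[>] 0) → ¬ LDConsistentAlong φ κ (map u atTop) rate S

end SignalDetection

/-!
The normalised statistic `ε⁻² T_ε / (2 A_ε)^{1/2}` is a centred quadratic form in independent
Gaussian variables. If no coordinate contributes more than `b` to it, then its logarithmic moment
generating function under the signal `S` is `t B(S) + t² / 2` up to an error of order
`b t² (|t| + B(S))`. Exponential tilting turns this into `-log β(S) ∼ (B(S) - x)² / 2`, as long as
`b (B(S) - x) → 0`.
Under the thresholds `x = -√r_ε`, whose level tends to one, this shows that consistency forces
`B(S) ≥ c r_ε`; conversely a Chernoff bound shows that inconsistency forces `B(S₁) = o(r_ε)`. As `B`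
is a quadratic form, `B(S + S₁) - B(S)` is then negligible against the gap `B(S) - x`.

When the gap is so large that the Gaussian approximation fails, Hölder's inequality for the
likelihood ratio of the two signals bounds each of `-log β(S)` and `-log β(S + S₁)` by `p` times the
other plus `q ‖S₁‖² / (2 ε²)`, for any conjugate exponents `p` and `q`. The last term is negligible
because a Chernoff bound already makes `-log β(S)` much larger than `‖S₁‖² / ε²`.
-/

namespace SignalDetection

section GaussianSquare

theorem abs_log_one_add_sub_le {x : ℝ} (hx : |x| ≤ 1 / 2) :
    |Real.log (1 + x) - (x - x ^ 2 / 2)| ≤ 2 * |x| ^ 3 := by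
  have htaylor := Real.abs_log_sub_add_sum_range_le (x := -x) (by rw [abs_neg]; linarith) 2
  simp only [Finset.sum_range_succ, Finset.sum_range_zero, abs_neg, sub_neg_eq_add] at htaylor
  have hrem : |x| ^ (2 + 1) / (1 - |x|) ≤ 2 * |x| ^ 3 := by
    rw [div_le_iff₀ (by linarith), mul_comm (2 : ℝ), mul_assoc]
    exact le_mul_of_one_le_right (by positivity) (by linarith)
  refine le_trans (le_of_eq ?_) (htaylor.trans hrem)
  congr 1
  push_cast
  ring

variable {m t : ℝ} {v : NNReal}

theorem gaussianPDFReal_mul_exp_mul_sq (hv : v ≠ 0) (ht : 2 * t * v < 1) (y : ℝ) :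
    gaussianPDFReal m v y * Real.exp (t * y ^ 2) =
      ((√(1 - 2 * t * v))⁻¹ * Real.exp (t * m ^ 2 / (1 - 2 * t * v))) *
        gaussianPDFReal (m / (1 - 2 * t * v)) (v / Real.toNNReal (1 - 2 * t * v)) y := by
  obtain ⟨d, hd⟩ : ∃ d, d = 1 - 2 * t * v := ⟨_, rfl⟩
  have hd0 : 0 < d := by linarith
  have ht : t = (1 - d) / (2 * v) := by rw [hd]; field_simp; ring
  rw [← hd]
  subst ht
  simp only [gaussianPDFReal, NNReal.coe_div, Real.coe_toNNReal _ hd0.le]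
  have hsqrt : √(2 * Real.pi * (v / d)) = √(2 * Real.pi * v) / √d := by
    rw [← Real.sqrt_div' _ hd0.le, mul_div_assoc]
  have hsqrt0 : √d ≠ 0 := (Real.sqrt_pos.2 hd0).ne'
  have hexponent : -(y - m) ^ 2 / (2 * v) + (1 - d) / (2 * v) * y ^ 2 =
      (1 - d) / (2 * v) * m ^ 2 / d + -(y - m / d) ^ 2 / (2 * (v / d)) := by
    field_simp
    ring
  rw [hsqrt, inv_div, mul_assoc, ← Real.exp_add, hexponent, Real.exp_add]
  field_simp

theorem mgf_sq_gaussianReal (ht : 2 * t * v < 1) :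
    mgf (fun y => y ^ 2) (gaussianReal m v) t =
      (√(1 - 2 * t * v))⁻¹ * Real.exp (t * m ^ 2 / (1 - 2 * t * v)) := by
  rcases eq_or_ne v 0 with rfl | hv
  · simp [mgf]
  · have hvar : v / Real.toNNReal (1 - 2 * t * v) ≠ 0 :=
      (div_pos (pos_iff_ne_zero.2 hv) (Real.toNNReal_pos.2 (by linarith))).ne'
    simp_rw [mgf, integral_gaussianReal_eq_integral_smul hv, smul_eq_mul,
      gaussianPDFReal_mul_exp_mul_sq hv ht]
    rw [integral_const_mul, integral_gaussianPDFReal_eq_one _ hvar, mul_one]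

theorem abs_log_mgf_sq_gaussianReal_sub_le (ht : |t * v| ≤ 1 / 4) :
    |Real.log (mgf (fun y => y ^ 2) (gaussianReal m v) t) - (t * (v + m ^ 2) + (t * v) ^ 2)| ≤
      8 * |t * v| ^ 3 + 4 * t ^ 2 * v * m ^ 2 := by
  have htv := abs_le.1 ht
  have hd : 1 / 2 ≤ 1 - 2 * t * v := by linarith
  have hlog : |Real.log (1 + -(2 * (t * v))) - (-(2 * (t * v)) - (-(2 * (t * v))) ^ 2 / 2)| ≤
      16 * |t * v| ^ 3 := by
    refine (abs_log_one_add_sub_le ?_).trans (le_of_eq ?_)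
    · rw [abs_neg, abs_mul, abs_two]; linarith
    · rw [abs_neg, abs_mul, abs_two]; ring
  have hquot : |t * m ^ 2 / (1 - 2 * t * v) - t * m ^ 2| ≤ 4 * t ^ 2 * v * m ^ 2 := by
    have hfrac : t * m ^ 2 / (1 - 2 * t * v) - t * m ^ 2 =
        2 * t ^ 2 * v * m ^ 2 / (1 - 2 * t * v) := by
      have hd0 : 1 - 2 * t * v ≠ 0 := by linarith
      rw [eq_div_iff hd0, sub_mul, div_mul_cancel₀ _ hd0]
      ring
    have hnum : 0 ≤ 2 * t ^ 2 * v * m ^ 2 := by positivity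
    rw [hfrac, abs_of_nonneg (by positivity), div_le_iff₀ (by linarith)]
    nlinarith
  rw [mgf_sq_gaussianReal (by linarith), Real.log_mul (by positivity) (Real.exp_pos _).ne',
    Real.log_inv, Real.log_sqrt (by linarith), Real.log_exp]
  rw [show 1 - 2 * t * v = 1 + -(2 * (t * v)) by ring] at hquot ⊢
  rw [abs_le] at hlog hquot ⊢
  constructor <;> linarith

end GaussianSquare

section ExponentialMoments

variable {Ω : Type*} {mΩ : MeasurableSpace Ω} {μ : Measure Ω}

theorem ae_summable_of_summable_integral_norm {ι E : Type*} [Countable ι] [NormedAddCommGroup E]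
    [CompleteSpace E] {F : ι → Ω → E} (hF : ∀ i, Integrable (F i) μ)
    (hsum : Summable fun i => ∫ ω, ‖F i ω‖ ∂μ) : ∀ᵐ ω ∂μ, Summable fun i => F i ω := by
  have hfin : ∑' i, eLpNorm (F i) 1 μ ≠ ⊤ := by
    simp_rw [eLpNorm_one_eq_lintegral_enorm, ← ofReal_integral_norm_eq_lintegral_enorm (hF _)]
    exact hsum.tsum_ofReal_ne_top
  filter_upwards [summable_norm_of_tsum_eLpNorm_ne_top le_rfl
    (fun i => (hF i).aestronglyMeasurable) hfin] with ω hω using hω.of_norm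

variable {X : ℕ → Ω → ℝ} {Y : Ω → ℝ} {T C t : ℝ}

theorem integrable_exp_mul_of_tendsto (hX : ∀ n, Integrable (fun ω => Real.exp (T * X n ω)) μ)
    (hlim : ∀ᵐ ω ∂μ, Tendsto (fun n => X n ω) atTop (𝓝 (Y ω))) (hbound : ∀ n, mgf (X n) μ T ≤ C) :
    Integrable (fun ω => Real.exp (T * Y ω)) μ := by
  have hexp : ∀ᵐ ω ∂μ, Tendsto (fun n => Real.exp (T * X n ω)) atTop (𝓝 (Real.exp (T * Y ω))) := by
    filter_upwards [hlim] with ω hω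
    exact (Real.continuous_exp.tendsto _).comp (hω.const_mul T)
  refine ⟨aestronglyMeasurable_of_tendsto_ae _ (fun n => (hX n).aestronglyMeasurable) hexp, ?_⟩
  have hnorm : ∀ n, ∫⁻ ω, ‖Real.exp (T * X n ω)‖ₑ ∂μ ≤ ENNReal.ofReal C := fun n => by
    rw [← ofReal_integral_norm_eq_lintegral_enorm (hX n)]
    simpa only [mgf, Real.norm_eq_abs, Real.abs_exp] using ENNReal.ofReal_le_ofReal (hbound n)
  calc ∫⁻ ω, ‖Real.exp (T * Y ω)‖ₑ ∂μ
      = ∫⁻ ω, liminf (fun n => ‖Real.exp (T * X n ω)‖ₑ) atTop ∂μ :=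
        lintegral_congr_ae (by filter_upwards [hexp] with ω hω using hω.enorm.liminf_eq.symm)
    _ ≤ liminf (fun n => ∫⁻ ω, ‖Real.exp (T * X n ω)‖ₑ ∂μ) atTop :=
        lintegral_liminf_le' fun n => (hX n).aestronglyMeasurable.enorm
    _ ≤ ENNReal.ofReal C := liminf_le_of_le (h := fun b hb => by
        obtain ⟨n, hn⟩ := hb.exists
        exact hn.trans (hnorm n))
    _ < ⊤ := ENNReal.ofReal_lt_top

theorem tendsto_mgf_of_monotone (hX₀ : ∀ᵐ ω ∂μ, ∀ n, 0 ≤ X n ω)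
    (hmono : ∀ᵐ ω ∂μ, Monotone fun n => X n ω) (hXm : ∀ n, AEMeasurable (X n) μ)
    (hlim : ∀ᵐ ω ∂μ, Tendsto (fun n => X n ω) atTop (𝓝 (Y ω)))
    (hY : Integrable (fun ω => Real.exp (|t| * Y ω)) μ) :
    Tendsto (fun n => mgf (X n) μ t) atTop (𝓝 (mgf Y μ t)) := by
  refine tendsto_integral_of_dominated_convergence (fun ω => Real.exp (|t| * Y ω))
    (fun n => ((hXm n).const_mul t).exp.aestronglyMeasurable) hY (fun n => ?_) ?_
  · filter_upwards [hX₀, hmono, hlim] with ω h₀ hm hl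
    rw [Real.norm_eq_abs, Real.abs_exp, Real.exp_le_exp]
    calc t * X n ω ≤ |t| * X n ω := mul_le_mul_of_nonneg_right (le_abs_self t) (h₀ n)
      _ ≤ |t| * Y ω := mul_le_mul_of_nonneg_left (hm.ge_of_tendsto hl n) (abs_nonneg t)
  · filter_upwards [hlim] with ω hω
    exact (Real.continuous_exp.tendsto _).comp (hω.const_mul t)

end ExponentialMoments

/-- Law of independent Gaussian variables with means `m i` and common variance `v`. The law
`observationLaw` of the observed coefficients is of this form. -/
noncomputable abbrev gaussianProduct {ι : Type*} (m : ι → ℝ) (v : NNReal) : Measure (ι → ℝ) :=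
  Measure.infinitePi fun i => gaussianReal (m i) v

/-- The weighted sum of squares `∑ i, w i * y i ^ 2`, with the junk value `0` where it diverges. -/
noncomputable def quadForm (w y : ℕ → ℝ) : ℝ := ∑' i, w i * y i ^ 2

/-- The first `n` terms of `quadForm w y`. -/
def quadPartial (w : ℕ → ℝ) (n : ℕ) (y : ℕ → ℝ) : ℝ := ∑ i ∈ Finset.range n, w i * y i ^ 2

section QuadForm

variable {w m : ℕ → ℝ} {v : NNReal} {b t : ℝ}

@[fun_prop]
theorem measurable_quadPartial (w : ℕ → ℝ) (n : ℕ) : Measurable (quadPartial w n) := by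
  unfold quadPartial
  fun_prop

theorem measurable_quadForm (w : ℕ → ℝ) : Measurable (quadForm w) :=
  Measurable.tsum fun i => by fun_prop

theorem quadPartial_nonneg (hw : ∀ i, 0 ≤ w i) (n : ℕ) (y : ℕ → ℝ) : 0 ≤ quadPartial w n y :=
  Finset.sum_nonneg fun i _ => mul_nonneg (hw i) (sq_nonneg _)

theorem monotone_quadPartial (hw : ∀ i, 0 ≤ w i) (y : ℕ → ℝ) :
    Monotone fun n => quadPartial w n y :=
  fun _ _ hmn => Finset.sum_le_sum_of_subset_of_nonneg (Finset.range_mono hmn)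
    fun i _ _ => mul_nonneg (hw i) (sq_nonneg _)

theorem integral_sq_gaussianReal (m : ℝ) (v : NNReal) :
    ∫ y, y ^ 2 ∂(gaussianReal m v) = v + m ^ 2 := by
  have hvar := variance_eq_sub (memLp_id_gaussianReal' (μ := m) (v := v) 2 (by simp))
  simp only [variance_id_gaussianReal, Pi.pow_apply, id_eq, integral_id_gaussianReal] at hvar
  linarith

theorem ae_tendsto_quadPartial (hw : ∀ i, 0 ≤ w i) (hws : Summable w)
    (hwm : Summable fun i => w i * m i ^ 2) :
    ∀ᵐ y ∂(gaussianProduct m v), Tendsto (fun n => quadPartial w n y) atTop (𝓝 (quadForm w y)) := by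
  have heval : ∀ i, MeasurePreserving (Function.eval i) (gaussianProduct m v)
      (gaussianReal (m i) v) := measurePreserving_eval_infinitePi _
  have hint : ∀ i, Integrable (fun y => w i * y i ^ 2) (gaussianProduct m v) := fun i =>
    (heval i).integrable_comp_of_integrable
      ((memLp_id_gaussianReal' 2 (by simp)).integrable_sq.const_mul (w i))
  have hmean : ∀ i, ∫ y, ‖w i * y i ^ 2‖ ∂(gaussianProduct m v) = w i * v + w i * m i ^ 2 := by
    intro i
    have hnorm : ∀ y : ℕ → ℝ, ‖w i * y i ^ 2‖ = w i * y i ^ 2 := fun y =>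
      Real.norm_of_nonneg (mul_nonneg (hw i) (sq_nonneg _))
    simp_rw [hnorm]
    rw [integral_const_mul, ← mul_add, ← integral_sq_gaussianReal, ← (heval i).map_eq,
      integral_map (heval i).aemeasurable (by fun_prop)]
  have hsum : Summable fun i => ∫ y, ‖w i * y i ^ 2‖ ∂(gaussianProduct m v) := by
    simpa only [hmean] using (hws.mul_right (v : ℝ)).add hwm
  filter_upwards [ae_summable_of_summable_integral_norm hint hsum] with y hy
  exact hy.hasSum.tendsto_sum_nat

theorem mgf_quadPartial (w m : ℕ → ℝ) (v : NNReal) (n : ℕ) (t : ℝ) :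
    mgf (quadPartial w n) (gaussianProduct m v) t =
      ∏ i ∈ Finset.range n, mgf (fun y => y ^ 2) (gaussianReal (m i) v) (t * w i) := by
  have hindep := iIndepFun_infinitePi (P := fun i => gaussianReal (m i) v)
    (X := fun i y => w i * y ^ 2) fun i => by fun_prop
  have hsum : quadPartial w n = ∑ i ∈ Finset.range n, fun y : ℕ → ℝ => w i * y i ^ 2 := by
    ext y
    simp only [quadPartial, Finset.sum_apply]
  rw [hsum, hindep.mgf_sum (fun i => by fun_prop)]
  refine Finset.prod_congr rfl fun i _ => ?_
  have heval := measurePreserving_eval_infinitePi (fun i => gaussianReal (m i) v) i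
  rw [← heval.map_eq, mgf_map heval.aemeasurable (by fun_prop)]
  simp only [mgf, mul_assoc, Function.comp_apply, Function.eval]

theorem mgf_sq_gaussianReal_pos {m : ℝ} (ht : |t * v| ≤ 1 / 4) :
    0 < mgf (fun y => y ^ 2) (gaussianReal m v) t := by
  have htv := abs_le.1 ht
  rw [mgf_sq_gaussianReal (by linarith)]
  have : 0 < 1 - 2 * t * v := by linarith
  positivity

theorem abs_log_mgf_quadPartial_sub_le (hw : ∀ i, 0 ≤ w i) (hb : ∀ i, w i * v ≤ b)
    (ht : |t| * b ≤ 1 / 4) (n : ℕ) :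
    |Real.log (mgf (quadPartial w n) (gaussianProduct m v) t) -
        ∑ i ∈ Finset.range n, (t * (v * w i + w i * m i ^ 2) + t ^ 2 * (v ^ 2 * w i ^ 2))| ≤
      ∑ i ∈ Finset.range n, 4 * t ^ 2 * b * (2 * |t| * (v ^ 2 * w i ^ 2) + w i * m i ^ 2) := by
  have habs : ∀ i, |t * w i * v| = |t| * (w i * v) := fun i => by
    rw [mul_assoc, abs_mul t, abs_of_nonneg (mul_nonneg (hw i) v.coe_nonneg)]
  have hsmall : ∀ i, |t * w i * v| ≤ 1 / 4 := fun i =>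
    (habs i).le.trans ((mul_le_mul_of_nonneg_left (hb i) (abs_nonneg t)).trans ht)
  rw [mgf_quadPartial, Real.log_prod fun i _ => (mgf_sq_gaussianReal_pos (hsmall i)).ne',
    ← Finset.sum_sub_distrib]
  refine (Finset.abs_sum_le_sum_abs _ _).trans (Finset.sum_le_sum fun i _ => ?_)
  have hterm := abs_log_mgf_sq_gaussianReal_sub_le (m := m i) (hsmall i)
  have hmain : t * w i * (v + m i ^ 2) + (t * w i * v) ^ 2 =
      t * (v * w i + w i * m i ^ 2) + t ^ 2 * (v ^ 2 * w i ^ 2) := by ring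
  rw [hmain, habs i] at hterm
  calc _ ≤ 8 * (|t| * (w i * v)) ^ 3 + 4 * (t * w i) ^ 2 * v * m i ^ 2 := hterm
    _ = 4 * t ^ 2 * (w i * v) * (2 * |t| * (v ^ 2 * w i ^ 2) + w i * m i ^ 2) := by
      rw [← sq_abs t, mul_pow t, ← sq_abs t]
      ring
    _ ≤ _ := by
      have := hw i
      gcongr
      exact hb i

end QuadForm

section QuadForm

variable {w m : ℕ → ℝ} {v : NNReal} {b t W D A : ℝ}

theorem tendsto_log_mgf_bounds (hW : HasSum w W) (hD : HasSum (fun i => w i * m i ^ 2) D)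
    (hA : HasSum (fun i => w i ^ 2) A) (v b t : ℝ) :
    Tendsto (fun n => ∑ i ∈ Finset.range n,
        (t * (v * w i + w i * m i ^ 2) + t ^ 2 * (v ^ 2 * w i ^ 2))) atTop
        (𝓝 (t * (v * W + D) + t ^ 2 * (v ^ 2 * A))) ∧
      Tendsto (fun n => ∑ i ∈ Finset.range n,
        4 * t ^ 2 * b * (2 * |t| * (v ^ 2 * w i ^ 2) + w i * m i ^ 2)) atTop
        (𝓝 (4 * t ^ 2 * b * (2 * |t| * (v ^ 2 * A) + D))) :=
  ⟨((((hW.mul_left v).add hD).mul_left t).add ((hA.mul_left _).mul_left _)).tendsto_sum_nat,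
    ((((hA.mul_left _).mul_left _).add hD).mul_left _).tendsto_sum_nat⟩

theorem mgf_quadPartial_pos (hw : ∀ i, 0 ≤ w i) (hb : ∀ i, w i * v ≤ b)
    (ht : |t| * b ≤ 1 / 4) (n : ℕ) : 0 < mgf (quadPartial w n) (gaussianProduct m v) t := by
  rw [mgf_quadPartial]
  refine Finset.prod_pos fun i _ => mgf_sq_gaussianReal_pos ?_
  rw [mul_assoc, abs_mul t, abs_of_nonneg (mul_nonneg (hw i) v.coe_nonneg)]
  exact (mul_le_mul_of_nonneg_left (hb i) (abs_nonneg t)).trans ht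

variable (hw : ∀ i, 0 ≤ w i) (hW : HasSum w W) (hD : HasSum (fun i => w i * m i ^ 2) D)
  (hA : HasSum (fun i => w i ^ 2) A) (hb : ∀ i, w i * v ≤ b) (ht : |t| * b ≤ 1 / 4)
include hw hW hD hA hb ht

theorem integrable_exp_mul_quadForm :
    Integrable (fun y => Real.exp (t * quadForm w y)) (gaussianProduct m v) := by
  obtain ⟨hmain, herr⟩ := tendsto_log_mgf_bounds hW hD hA v b t
  obtain ⟨C, hC⟩ := (hmain.add herr).bddAbove_range
  refine integrable_exp_mul_of_tendsto (C := Real.exp C)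
    (fun n => mgf_pos_iff.1 (mgf_quadPartial_pos hw hb ht n))
    (ae_tendsto_quadPartial hw hW.summable hD.summable) fun n => ?_
  rw [← Real.log_le_iff_le_exp (mgf_quadPartial_pos hw hb ht n)]
  have hlog := (abs_le.1 (abs_log_mgf_quadPartial_sub_le (m := m) hw hb ht n)).2
  have hCn := hC (Set.mem_range_self n)
  linarith

theorem abs_log_mgf_quadForm_sub_le :
    |Real.log (mgf (quadForm w) (gaussianProduct m v) t) -
        (t * (v * W + D) + t ^ 2 * (v ^ 2 * A))| ≤
      4 * t ^ 2 * b * (2 * |t| * (v ^ 2 * A) + D) := by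
  have hint : ∀ s, |s| * b ≤ 1 / 4 →
      Integrable (fun y => Real.exp (s * quadForm w y)) (gaussianProduct m v) := fun s hs =>
    integrable_exp_mul_quadForm hw hW hD hA hb hs
  have hmgf : Tendsto (fun n => mgf (quadPartial w n) (gaussianProduct m v) t) atTop
      (𝓝 (mgf (quadForm w) (gaussianProduct m v) t)) :=
    tendsto_mgf_of_monotone (ae_of_all _ fun y n => quadPartial_nonneg hw n y)
      (ae_of_all _ (monotone_quadPartial hw)) (fun n => by fun_prop)
      (ae_tendsto_quadPartial hw hW.summable hD.summable) (hint |t| (by rwa [abs_abs]))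
  obtain ⟨hmain, herr⟩ := tendsto_log_mgf_bounds hW hD hA v b t
  exact le_of_tendsto_of_tendsto' ((hmgf.log (mgf_pos (hint t ht)).ne').sub hmain).abs herr
    (abs_log_mgf_quadPartial_sub_le hw hb ht)

end QuadForm

section GaussianTail

variable {Ω : Type*} {mΩ : MeasurableSpace Ω} {μ : Measure Ω} {Y : Ω → ℝ}

theorem mgf_le_tail_add_tilted [IsFiniteMeasure μ] (hY : Measurable Y) {a c t u : ℝ} (ht : 0 ≤ t)
    (hu : 0 ≤ u) (hint : Integrable (fun ω => Real.exp (t * Y ω)) μ)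
    (hsub : Integrable (fun ω => Real.exp ((t - u) * Y ω)) μ)
    (hadd : Integrable (fun ω => Real.exp ((t + u) * Y ω)) μ) :
    mgf Y μ t ≤ Real.exp (t * c) * μ.real {ω | a ≤ Y ω} + Real.exp (u * a) * mgf Y μ (t - u) +
      Real.exp (-(u * c)) * mgf Y μ (t + u) := by
  have hmeas : MeasurableSet {ω | a ≤ Y ω} := measurableSet_le measurable_const hY
  have htail : Integrable ({ω | a ≤ Y ω}.indicator fun _ => Real.exp (t * c)) μ :=
    (integrable_const _).indicator hmeas
  have hpointwise : ∀ ω, Real.exp (t * Y ω) ≤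
      {ω | a ≤ Y ω}.indicator (fun _ => Real.exp (t * c)) ω +
        Real.exp (u * a) * Real.exp ((t - u) * Y ω) +
        Real.exp (-(u * c)) * Real.exp ((t + u) * Y ω) := by
    intro ω
    rw [← Real.exp_add, ← Real.exp_add]
    have hind : 0 ≤ {ω | a ≤ Y ω}.indicator (fun _ => Real.exp (t * c)) ω :=
      Set.indicator_nonneg (fun _ _ => (Real.exp_pos _).le) ω
    have hlow := Real.exp_pos (u * a + (t - u) * Y ω)
    have hhigh := Real.exp_pos (-(u * c) + (t + u) * Y ω)
    rcases lt_or_ge (Y ω) a with hYa | haY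
    · have : Real.exp (t * Y ω) ≤ Real.exp (u * a + (t - u) * Y ω) :=
        Real.exp_le_exp.2 (by nlinarith)
      linarith
    rcases le_or_gt (Y ω) c with hYc | hcY
    · have : Real.exp (t * Y ω) ≤ Real.exp (t * c) :=
        Real.exp_le_exp.2 (mul_le_mul_of_nonneg_left hYc ht)
      rw [Set.indicator_of_mem (show ω ∈ {ω | a ≤ Y ω} from haY)]
      linarith
    · have : Real.exp (t * Y ω) ≤ Real.exp (-(u * c) + (t + u) * Y ω) :=
        Real.exp_le_exp.2 (by nlinarith)
      linarith
  refine (integral_mono hint ((htail.add (hsub.const_mul _)).add (hadd.const_mul _))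
    hpointwise).trans (le_of_eq ?_)
  rw [integral_add' (htail.add (hsub.const_mul _)) (hadd.const_mul _),
    integral_add' htail (hsub.const_mul _), integral_indicator_const _ hmeas, smul_eq_mul,
    integral_const_mul, integral_const_mul, mul_comm (μ.real _)]
  rfl

theorem integrable_exp_mul_of_mgf_mem_Icc {t a c : ℝ}
    (h : mgf Y μ t ∈ Set.Icc (Real.exp a) c) : Integrable (fun ω => Real.exp (t * Y ω)) μ := by
  by_contra hint
  rw [mgf_undef hint] at h
  exact (Real.exp_pos a).not_ge h.1

/-- Tilting by `(1 + δ)τ` concentrates the mass in the window `[τ, (1 + 2δ)τ]`. -/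
theorem exp_le_measureReal_ge_of_mgf_mem_Icc [IsFiniteMeasure μ] (hY : Measurable Y)
    {τ δ e : ℝ} (hτ : 0 ≤ τ) (hδ : 0 ≤ δ) (he : 2 * e + Real.log 4 ≤ δ ^ 2 * τ ^ 2 / 2)
    (hmgf : ∀ t ∈ Set.Icc τ ((1 + 2 * δ) * τ),
      mgf Y μ t ∈ Set.Icc (Real.exp (t ^ 2 / 2 - e)) (Real.exp (t ^ 2 / 2 + e))) :
    Real.exp (-((1 + 2 * δ) ^ 2 * (τ ^ 2 / 2))) ≤ μ.real {ω | τ ≤ Y ω} := by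
  have hδτ : 0 ≤ δ * τ := mul_nonneg hδ hτ
  have hmid := hmgf ((1 + δ) * τ) ⟨by linarith, by linarith⟩
  have hlow := hmgf ((1 + δ) * τ - δ * τ) ⟨by linarith, by linarith⟩
  have hhigh := hmgf ((1 + δ) * τ + δ * τ) ⟨by linarith, by linarith⟩
  have hwindow := mgf_le_tail_add_tilted hY (a := τ) (c := (1 + 2 * δ) * τ)
    (by positivity : 0 ≤ (1 + δ) * τ) hδτ (integrable_exp_mul_of_mgf_mem_Icc hmid)
    (integrable_exp_mul_of_mgf_mem_Icc hlow) (integrable_exp_mul_of_mgf_mem_Icc hhigh)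
  set G := Real.exp (((1 + δ) * τ) ^ 2 / 2 - e) with hG
  have hquarter : ∀ p q, p + q ≤ ((1 + δ) * τ) ^ 2 / 2 - δ ^ 2 * τ ^ 2 / 2 + e →
      Real.exp p * Real.exp q ≤ G / 4 := by
    intro p q hpq
    rw [← Real.exp_add, hG, ← Real.exp_log (show (0 : ℝ) < 4 by norm_num), ← Real.exp_sub,
      Real.exp_le_exp]
    linarith
  have hlow' : Real.exp (δ * τ * τ) * mgf Y μ ((1 + δ) * τ - δ * τ) ≤ G / 4 :=
    (mul_le_mul_of_nonneg_left hlow.2 (Real.exp_pos _).le).trans (hquarter _ _ (by nlinarith))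
  have hhigh' : Real.exp (-(δ * τ * ((1 + 2 * δ) * τ))) * mgf Y μ ((1 + δ) * τ + δ * τ) ≤ G / 4 :=
    (mul_le_mul_of_nonneg_left hhigh.2 (Real.exp_pos _).le).trans (hquarter _ _ (by nlinarith))
  have hhalf : G / 2 ≤ Real.exp ((1 + δ) * τ * ((1 + 2 * δ) * τ)) * μ.real {ω | τ ≤ Y ω} := by
    linarith [hmid.1]
  refine le_of_mul_le_mul_left (le_trans ?_ hhalf)
    (Real.exp_pos ((1 + δ) * τ * ((1 + 2 * δ) * τ)))
  have hG₂ : G / 2 = Real.exp (((1 + δ) * τ) ^ 2 / 2 - e - Real.log 2) := by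
    rw [hG, Real.exp_sub _ (Real.log 2), Real.exp_log two_pos]
  have hlog : Real.log 4 = 2 * Real.log 2 := by
    rw [show (4 : ℝ) = 2 ^ 2 by norm_num, Real.log_pow, Nat.cast_ofNat]
  rw [← Real.exp_add, hG₂, Real.exp_le_exp]
  nlinarith [sq_nonneg (δ * τ), mul_nonneg hδ (sq_nonneg τ)]

theorem neg_log_measureReal_ge_isEquivalent {ι Ω : Type*} {mΩ : MeasurableSpace Ω} {l : Filter ι}
    {μ : ι → Measure Ω} [∀ i, IsFiniteMeasure (μ i)] {Y : ι → Ω → ℝ}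
    (hY : ∀ i, Measurable (Y i)) {τ : ι → ℝ} (hτ : Tendsto τ l atTop)
    (hmgf : ∀ η > 0, ∀ᶠ i in l, ∀ t ∈ Set.Icc (τ i) (3 * τ i), mgf (Y i) (μ i) t ∈
      Set.Icc (Real.exp (t ^ 2 / 2 - η * τ i ^ 2)) (Real.exp (t ^ 2 / 2 + η * τ i ^ 2))) :
    (fun i => -Real.log ((μ i).real {ω | τ i ≤ Y i ω})) ~[l] fun i => τ i ^ 2 / 2 := by
  refine isLittleO_iff.2 fun c hc => ?_
  obtain ⟨δ, hδ, hδ₁, hδc⟩ : ∃ δ > 0, δ ≤ 1 ∧ 8 * δ ≤ c :=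
    ⟨min 1 (c / 8), by positivity, min_le_left _ _, by linarith [min_le_right 1 (c / 8)]⟩
  have hlarge : ∀ᶠ i in l, Real.log 4 ≤ δ ^ 2 / 4 * τ i ^ 2 :=
    (((tendsto_pow_atTop two_ne_zero).comp hτ).const_mul_atTop
      (by positivity)).eventually_ge_atTop _
  filter_upwards [hlarge, hτ.eventually_ge_atTop 0, hmgf (δ ^ 2 / 8) (by positivity)]
    with i hi hτi hmgfi
  have hlower := exp_le_measureReal_ge_of_mgf_mem_Icc (hY i) hτi hδ.le (e := δ ^ 2 / 8 * τ i ^ 2)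
    (by linarith) fun t ht => hmgfi t ⟨ht.1, ht.2.trans (by nlinarith)⟩
  have hpos : 0 < (μ i).real {ω | τ i ≤ Y i ω} := (Real.exp_pos _).trans_le hlower
  have hmgfτ := hmgfi (τ i) ⟨le_rfl, by linarith⟩
  have hupper : (μ i).real {ω | τ i ≤ Y i ω} ≤
      Real.exp (-τ i * τ i + (τ i ^ 2 / 2 + δ ^ 2 / 8 * τ i ^ 2)) := by
    rw [Real.exp_add]
    exact (measure_ge_le_exp_mul_mgf _ hτi (integrable_exp_mul_of_mgf_mem_Icc hmgfτ)).trans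
      (mul_le_mul_of_nonneg_left hmgfτ.2 (Real.exp_pos _).le)
  rw [← Real.le_log_iff_exp_le hpos] at hlower
  rw [← Real.log_le_iff_le_exp hpos] at hupper
  have hsq : 0 ≤ τ i ^ 2 / 2 := by positivity
  rw [Pi.sub_apply, Real.norm_eq_abs, Real.norm_of_nonneg hsq, abs_le]
  have hδ₂ : δ ^ 2 * (τ i ^ 2 / 2) ≤ δ * (τ i ^ 2 / 2) :=
    mul_le_mul_of_nonneg_right (by nlinarith) hsq
  have hδτ : 8 * δ * (τ i ^ 2 / 2) ≤ c * (τ i ^ 2 / 2) := mul_le_mul_of_nonneg_right hδc hsq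
  constructor <;> nlinarith [mul_nonneg hδ.le hsq]

end GaussianTail

section ProductDensity

theorem withDensity_apply_le_rpow {Ω : Type*} {mΩ : MeasurableSpace Ω} {μ : Measure Ω} {p q : ℝ}
    (hpq : p.HolderConjugate q) {f : Ω → ENNReal} (hf : AEMeasurable f μ) {E : Set Ω}
    (hE : MeasurableSet E) :
    μ.withDensity f E ≤ (∫⁻ ω, f ω ^ q ∂μ) ^ (1 / q) * μ E ^ (1 / p) := by
  have hone : ∀ ω, E.indicator f ω = E.indicator (fun _ => 1) ω * f ω := fun ω => by
    by_cases hω : ω ∈ E <;> simp [hω]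
  have hpow : ∀ ω, (E.indicator (fun _ => (1 : ENNReal)) ω) ^ p = E.indicator (fun _ => 1) ω :=
    fun ω => by by_cases hω : ω ∈ E <;> simp [hω, hpq.pos]
  calc μ.withDensity f E = ∫⁻ ω, E.indicator (fun _ => 1) ω * f ω ∂μ := by
        rw [withDensity_apply _ hE, ← lintegral_indicator hE, lintegral_congr hone]
    _ ≤ (∫⁻ ω, (E.indicator (fun _ => (1 : ENNReal)) ω) ^ p ∂μ) ^ (1 / p) *
          (∫⁻ ω, f ω ^ q ∂μ) ^ (1 / q) :=
        ENNReal.lintegral_mul_le_Lp_mul_Lq μ hpq (measurable_const.indicator hE).aemeasurable hf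
    _ = (∫⁻ ω, f ω ^ q ∂μ) ^ (1 / q) * μ E ^ (1 / p) := by
        rw [lintegral_congr hpow, lintegral_indicator_const hE, one_mul, mul_comm]

variable {ι : Type*} [Fintype ι] {Ω : ι → Type*} {mΩ : ∀ i, MeasurableSpace (Ω i)}
  {μ : ∀ i, Measure (Ω i)} [∀ i, IsProbabilityMeasure (μ i)] {f : ∀ i, Ω i → ENNReal}

theorem lintegral_pi_prod (hf : ∀ i, Measurable (f i)) :
    ∫⁻ ω, ∏ i, f i (ω i) ∂(Measure.pi μ) = ∏ i, ∫⁻ ω, f i ω ∂(μ i) := by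
  rw [lintegral_prod_eq_prod_lintegral_of_indepFun _ _
    (iIndepFun_pi fun i => (hf i).aemeasurable) fun i => (hf i).comp (measurable_pi_apply i)]
  exact Finset.prod_congr rfl fun i _ => (measurePreserving_eval μ i).lintegral_comp (hf i)

theorem pi_withDensity (hf : ∀ i, Measurable (f i)) [∀ i, SigmaFinite ((μ i).withDensity (f i))] :
    Measure.pi (fun i => (μ i).withDensity (f i)) =
      (Measure.pi μ).withDensity fun ω => ∏ i, f i (ω i) := by
  refine Measure.pi_eq fun s hs => ?_
  have hind : ∀ ω, (Set.univ.pi s).indicator (fun ω => ∏ i, f i (ω i)) ω =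
      ∏ i, (s i).indicator (f i) (ω i) := fun ω => by
    by_cases hω : ω ∈ Set.univ.pi s
    · rw [Set.indicator_of_mem hω]
      exact Finset.prod_congr rfl fun i _ => (Set.indicator_of_mem (hω i (Set.mem_univ i)) _).symm
    · rw [Set.indicator_of_notMem hω]
      obtain ⟨i, hi⟩ : ∃ i, ω i ∉ s i := by simpa only [Set.mem_univ_pi, not_forall] using hω
      exact (Finset.prod_eq_zero (Finset.mem_univ i) (Set.indicator_of_notMem hi _)).symm
  rw [withDensity_apply _ (MeasurableSet.univ_pi hs),
    ← lintegral_indicator (MeasurableSet.univ_pi hs), lintegral_congr hind,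
    lintegral_pi_prod fun i => (hf i).indicator (hs i)]
  exact Finset.prod_congr rfl fun i _ => by
    rw [lintegral_indicator (hs i), withDensity_apply _ (hs i)]

end ProductDensity

section SetAlgebra

variable {Ω : Type*} {mΩ : MeasurableSpace Ω} {μ ν : Measure Ω} [IsFiniteMeasure μ]
  [IsFiniteMeasure ν] {𝒜 : Set (Set Ω)}

theorem measureReal_le_of_forall_mem_isSetAlgebra (h𝒜 : IsSetAlgebra 𝒜)
    (hgen : mΩ = MeasurableSpace.generateFrom 𝒜) {f : ℝ → ℝ} (hf : Continuous f)
    (hle : ∀ t ∈ 𝒜, ν.real t ≤ f (μ.real t)) {E : Set Ω} (hE : MeasurableSet E) :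
    ν.real E ≤ f (μ.real E) := by
  have hdense := Measure.MeasureDense.of_generateFrom_isSetAlgebra_finite (μ + ν) h𝒜 hgen
  choose t ht htE using fun n : ℕ => hdense.approx E hE (measure_ne_top _ _) (1 / (n + 1))
    Nat.one_div_pos_of_nat
  have hclose : ∀ ρ : Measure Ω, IsFiniteMeasure ρ → ρ ≤ μ + ν →
      Tendsto (fun n => ρ.real (t n)) atTop (𝓝 (ρ.real E)) := by
    intro ρ _ hρ
    refine tendsto_iff_dist_tendsto_zero.2 (squeeze_zero (fun _ => dist_nonneg) (fun n => ?_)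
      tendsto_one_div_add_atTop_nhds_zero_nat)
    have htn := hdense.measurable _ (ht n)
    rw [dist_comm, Real.dist_eq]
    exact (abs_measureReal_sub_le_measureReal_symmDiff hE.nullMeasurableSet
      htn.nullMeasurableSet).trans
      (ENNReal.toReal_le_of_le_ofReal Nat.one_div_pos_of_nat.le ((hρ _).trans (htE n).le))
  exact le_of_tendsto_of_tendsto' (hclose ν ‹_› (Measure.le_add_left le_rfl))
    ((hf.tendsto _).comp (hclose μ ‹_› (Measure.le_add_right le_rfl))) fun n => hle _ (ht n)

end SetAlgebra

/-- The density of `N(m', v)` with respect to `N(m, v)`, for `v ≠ 0`. -/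
noncomputable def gaussianLikelihoodRatio (v : NNReal) (m m' y : ℝ) : ENNReal :=
  ENNReal.ofReal (Real.exp ((m' - m) / v * y - (m' ^ 2 - m ^ 2) / (2 * v)))

section GaussianShift

variable {v : NNReal}

@[fun_prop]
theorem measurable_gaussianLikelihoodRatio (v : NNReal) (m m' : ℝ) :
    Measurable (gaussianLikelihoodRatio v m m') := by
  unfold gaussianLikelihoodRatio
  fun_prop

theorem gaussianReal_withDensity_likelihoodRatio (hv : v ≠ 0) (m m' : ℝ) :
    (gaussianReal m v).withDensity (gaussianLikelihoodRatio v m m') = gaussianReal m' v := by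
  rw [gaussianReal_of_var_ne_zero m hv, gaussianReal_of_var_ne_zero m' hv,
    ← withDensity_mul _ (measurable_gaussianPDF m v) (by fun_prop)]
  congr 1
  ext y
  rw [Pi.mul_apply, gaussianPDF, gaussianPDF, gaussianLikelihoodRatio,
    ← ENNReal.ofReal_mul (gaussianPDFReal_nonneg _ _ _), gaussianPDFReal, gaussianPDFReal,
    mul_assoc (√(2 * Real.pi * v))⁻¹, ← Real.exp_add]
  congr 3
  field_simp
  ring

theorem lintegral_gaussianLikelihoodRatio_rpow (hv : v ≠ 0) (m m' q : ℝ) :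
    ∫⁻ y, gaussianLikelihoodRatio v m m' y ^ q ∂(gaussianReal m v) =
      ENNReal.ofReal (Real.exp (q * (q - 1) * ((m' - m) ^ 2 / (2 * v)))) := by
  have hpow : ∀ y, gaussianLikelihoodRatio v m m' y ^ q =
      ENNReal.ofReal (Real.exp (-(q * ((m' ^ 2 - m ^ 2) / (2 * v)))) *
        Real.exp (q * (m' - m) / v * y)) := fun y => by
    rw [gaussianLikelihoodRatio, ENNReal.ofReal_rpow_of_pos (Real.exp_pos _), ← Real.exp_mul,
      ← Real.exp_add]
    congr 2
    ring
  have hmgf : ∫ y, Real.exp (q * (m' - m) / v * y) ∂(gaussianReal m v) =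
      Real.exp (m * (q * (m' - m) / v) + v * (q * (m' - m) / v) ^ 2 / 2) :=
    congrFun mgf_id_gaussianReal _
  rw [lintegral_congr hpow, ← ofReal_integral_eq_lintegral_ofReal
    ((integrable_exp_mul_gaussianReal _).const_mul _) (ae_of_all _ fun y => by positivity),
    integral_const_mul, hmgf, ← Real.exp_add]
  congr 2
  field_simp
  ring

theorem pi_gaussianReal_shift_le {ι : Type*} [Fintype ι] (hv : v ≠ 0) (m m' : ι → ℝ) {p q : ℝ}
    (hpq : p.HolderConjugate q) {E : Set (ι → ℝ)} (hE : MeasurableSet E) :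
    Measure.pi (fun i => gaussianReal (m' i) v) E ≤
      ENNReal.ofReal (Real.exp ((q - 1) * ((∑ i, (m' i - m i) ^ 2) / (2 * v)))) *
        Measure.pi (fun i => gaussianReal (m i) v) E ^ (1 / p) := by
  have hprob : ∀ i, IsProbabilityMeasure
      ((gaussianReal (m i) v).withDensity (gaussianLikelihoodRatio v (m i) (m' i))) := fun i => by
    rw [gaussianReal_withDensity_likelihoodRatio hv]
    infer_instance
  have hmoment : (∫⁻ y : ι → ℝ, (∏ i, gaussianLikelihoodRatio v (m i) (m' i) (y i)) ^ q
      ∂(Measure.pi fun i => gaussianReal (m i) v)) ^ (1 / q) =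
      ENNReal.ofReal (Real.exp ((q - 1) * ((∑ i, (m' i - m i) ^ 2) / (2 * v)))) := by
    simp_rw [← ENNReal.prod_rpow_of_nonneg hpq.symm.nonneg]
    rw [lintegral_pi_prod (f := fun i y => gaussianLikelihoodRatio v (m i) (m' i) y ^ q)
      fun i => by fun_prop]
    simp_rw [lintegral_gaussianLikelihoodRatio_rpow hv]
    rw [← ENNReal.ofReal_prod_of_nonneg fun i _ => (Real.exp_pos _).le, ← Real.exp_sum,
      ENNReal.ofReal_rpow_of_pos (Real.exp_pos _), ← Real.exp_mul, ← Finset.mul_sum,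
      ← Finset.sum_div, mul_assoc q, mul_one_div, mul_div_cancel_left₀ _ hpq.symm.ne_zero]
  have hdensity : (fun i => gaussianReal (m' i) v) = fun i =>
      (gaussianReal (m i) v).withDensity (gaussianLikelihoodRatio v (m i) (m' i)) :=
    funext fun i => (gaussianReal_withDensity_likelihoodRatio hv _ _).symm
  rw [hdensity, pi_withDensity fun i => by fun_prop, ← hmoment]
  exact withDensity_apply_le_rpow hpq
    (Measurable.aemeasurable (Finset.measurable_fun_prod _ fun i _ => by fun_prop)) hE

theorem gaussianProduct_shift_le {ι : Type*} (hv : v ≠ 0) {m m' : ι → ℝ} {p q N : ℝ}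
    (hpq : p.HolderConjugate q) (hN : ∀ s : Finset ι, ∑ i ∈ s, (m' i - m i) ^ 2 ≤ N)
    {E : Set (ι → ℝ)} (hE : MeasurableSet E) :
    (gaussianProduct m' v).real E ≤
      Real.exp ((q - 1) * (N / (2 * v))) * (gaussianProduct m v).real E ^ (1 / p) := by
  refine measureReal_le_of_forall_mem_isSetAlgebra isSetAlgebra_measurableCylinders
    generateFrom_measurableCylinders.symm
    (f := fun x => Real.exp ((q - 1) * (N / (2 * v))) * x ^ (1 / p))
    (by have := hpq.pos; exact continuous_const.mul (Real.continuous_rpow_const (by positivity)))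
    (fun t ht => ?_) hE
  obtain ⟨s, S, hS, rfl⟩ := (mem_measurableCylinders t).1 ht
  have hcyl : ∀ m : ι → ℝ, (gaussianProduct m v).real (cylinder s S) =
      (Measure.pi fun i : s => gaussianReal (m i) v).real S := fun m => by
    rw [← Measure.infinitePi_map_restrict (fun i => gaussianReal (m i) v),
      map_measureReal_apply (by fun_prop) hS]
    rfl
  have hfinite := pi_gaussianReal_shift_le hv (fun i : s => m i) (fun i => m' i) hpq hS
  have hreal := ENNReal.toReal_mono (ENNReal.mul_ne_top ENNReal.ofReal_ne_top
    (ENNReal.rpow_ne_top_of_nonneg hpq.one_div_nonneg (measure_ne_top _ _))) hfinite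
  rw [ENNReal.toReal_mul, ENNReal.toReal_ofReal (Real.exp_pos _).le, ← ENNReal.toReal_rpow] at hreal
  rw [hcyl, hcyl]
  refine hreal.trans (mul_le_mul_of_nonneg_right (Real.exp_le_exp.2 ?_)
    (Real.rpow_nonneg measureReal_nonneg _))
  have hsum := (Finset.sum_coe_sort s fun i => (m' i - m i) ^ 2).trans_le (hN s)
  have hq := hpq.symm.sub_one_pos
  gcongr

end GaussianShift

/-- Weights of the normalised statistic `ε⁻² T_ε / (2 A_ε)^{1/2}` as a quadratic form. -/
noncomputable def testWeight (κ : ℝ → ℕ → ℝ) (ε : ℝ) (i : ℕ) : ℝ :=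
  κ ε i ^ 2 / (ε ^ 4 * √(2 * ACoef κ ε))

/-- The normalised statistic `ε⁻² T_ε / (2 A_ε)^{1/2}` that the test compares with its threshold. -/
noncomputable def normStat (κ : ℝ → ℕ → ℝ) (ε : ℝ) (y : ℕ → ℝ) : ℝ :=
  (ε ^ 2)⁻¹ * testStat κ ε y / √(2 * ACoef κ ε)

/-- At the noise level `ε` the weights are summable and not all zero, and no single coordinate
contributes more than `b` to the normalised statistic. Everything below is uniform over weights with
this property, and the Gaussian approximation is accurate as far as `b` times the scale is small. -/
structure WeightBound (κ : ℝ → ℕ → ℝ) (ε b : ℝ) : Prop where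
  noise_pos : 0 < ε
  summable : Summable fun i => κ ε i ^ 2
  aCoef_pos : 0 < ACoef κ ε
  sq_le : ∀ i, κ ε i ^ 2 ≤ b * (ε ^ 2 * √(2 * ACoef κ ε))

instance instIsProbabilityMeasureObservationLaw (φ : ℕ → Signal) (ε : ℝ) (S : Signal) :
    IsProbabilityMeasure (observationLaw φ ε S) := by
  unfold observationLaw
  infer_instance

section NormalisedStatistic

variable {φ : ℕ → Signal} {κ : ℝ → ℕ → ℝ} {ε b t x : ℝ} {S : Signal}

theorem testWeight_nonneg (κ : ℝ → ℕ → ℝ) (ε : ℝ) (i : ℕ) : 0 ≤ testWeight κ ε i := by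
  unfold testWeight
  positivity

theorem measurable_normStat (κ : ℝ → ℕ → ℝ) (ε : ℝ) : Measurable (normStat κ ε) := by
  have : Measurable fun y : ℕ → ℝ => ∑' i, κ ε i ^ 2 * y i ^ 2 :=
    measurable_quadForm fun i => κ ε i ^ 2
  unfold normStat testStat
  fun_prop

theorem summable_pow_four_of_aCoef_ne_zero (h : ACoef κ ε ≠ 0) :
    Summable fun i => κ ε i ^ 4 := by
  by_contra hns
  exact h (by rw [ACoef, tsum_eq_zero_of_not_summable hns, mul_zero])

theorem bCoef_nonneg (φ : ℕ → Signal) (κ : ℝ → ℕ → ℝ) (ε : ℝ) (S : Signal) :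
    0 ≤ BCoef φ κ ε S :=
  div_nonneg (mul_nonneg (by positivity) (tsum_nonneg fun i => by positivity)) (Real.sqrt_nonneg _)

theorem bCoef_zero (φ : ℕ → Signal) (κ : ℝ → ℕ → ℝ) (ε : ℝ) : BCoef φ κ ε 0 = 0 := by
  simp [BCoef, DCoef, fourierCoef]

theorem typeII_eq_measureReal_normStat_le (φ : ℕ → Signal) (κ : ℝ → ℕ → ℝ) (ε x : ℝ)
    (S : Signal) : typeII φ κ ε x S = (observationLaw φ ε S).real {y | normStat κ ε y ≤ x} := by
  rw [typeII, rejectionRegion, Set.compl_ofPred]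
  simp only [not_lt, normStat]

namespace WeightBound

variable (h : WeightBound κ ε b)
include h

theorem testWeight_mul_le (i : ℕ) : testWeight κ ε i * (ε ^ 2).toNNReal ≤ b := by
  have hε := h.noise_pos
  have hA := h.aCoef_pos
  rw [Real.coe_toNNReal _ (sq_nonneg ε), testWeight, div_mul_eq_mul_div,
    div_le_iff₀ (by positivity)]
  calc κ ε i ^ 2 * ε ^ 2 ≤ b * (ε ^ 2 * √(2 * ACoef κ ε)) * ε ^ 2 :=
        mul_le_mul_of_nonneg_right (h.sq_le i) (sq_nonneg ε)
    _ = b * (ε ^ 4 * √(2 * ACoef κ ε)) := by ring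

theorem bound_nonneg : 0 ≤ b :=
  (mul_nonneg (testWeight_nonneg κ ε 0) (NNReal.coe_nonneg _)).trans (h.testWeight_mul_le 0)

theorem hasSum_testWeight :
    HasSum (testWeight κ ε) (rhoSq κ ε / (ε ^ 4 * √(2 * ACoef κ ε))) :=
  h.summable.hasSum.div_const _

theorem hasSum_testWeight_sq : HasSum (fun i => testWeight κ ε i ^ 2) (1 / (2 * ε ^ 4)) := by
  have hε := h.noise_pos
  have hA := h.aCoef_pos
  have hfour := summable_pow_four_of_aCoef_ne_zero hA.ne'
  have hterm : ∀ i, testWeight κ ε i ^ 2 = κ ε i ^ 4 / (ε ^ 8 * (2 * ACoef κ ε)) := fun i => by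
    rw [testWeight, div_pow, mul_pow, Real.sq_sqrt (by positivity), ← pow_mul, ← pow_mul]
  have htotal : 1 / (2 * ε ^ 4) = (∑' i, κ ε i ^ 4) / (ε ^ 8 * (2 * ACoef κ ε)) := by
    have htsum : ∑' i, κ ε i ^ 4 = ε ^ 4 * ACoef κ ε := by
      rw [ACoef, mul_inv_cancel_left₀ (by positivity)]
    rw [htsum]
    field_simp
  rw [htotal, funext hterm]
  exact hfour.hasSum.div_const _

theorem hasSum_testWeight_mul_fourierCoef_sq (hφ : Orthonormal ℝ φ) (S : Signal) :
    HasSum (fun i => testWeight κ ε i * fourierCoef φ S i ^ 2) (BCoef φ κ ε S) := by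
  have hcoef : ∀ i, fourierCoef φ S i ^ 2 ≤ ‖S‖ ^ 2 := fun i => by
    have := abs_real_inner_le_norm (φ i) S
    rw [hφ.1 i, one_mul] at this
    exact sq_le_sq' (abs_le.1 this).1 (abs_le.1 this).2
  have hsum : Summable fun i => κ ε i ^ 2 * fourierCoef φ S i ^ 2 :=
    Summable.of_nonneg_of_le (fun i => by positivity)
      (fun i => mul_le_mul_of_nonneg_left (hcoef i) (sq_nonneg _)) (h.summable.mul_right (‖S‖ ^ 2))
  have hterm : ∀ i, testWeight κ ε i * fourierCoef φ S i ^ 2 =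
      κ ε i ^ 2 * fourierCoef φ S i ^ 2 / (ε ^ 4 * √(2 * ACoef κ ε)) := fun i =>
    div_mul_eq_mul_div _ _ _
  rw [BCoef, DCoef, inv_mul_eq_div, div_div, funext hterm]
  exact hsum.hasSum.div_const _

theorem normStat_eq (y : ℕ → ℝ) :
    normStat κ ε y = quadForm (testWeight κ ε) y -
      (ε ^ 2).toNNReal * (rhoSq κ ε / (ε ^ 4 * √(2 * ACoef κ ε))) := by
  have hε := h.noise_pos
  have hA := Real.sqrt_pos.2 (mul_pos two_pos h.aCoef_pos)
  have hquad : quadForm (testWeight κ ε) y =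
      (∑' i, κ ε i ^ 2 * y i ^ 2) / (ε ^ 4 * √(2 * ACoef κ ε)) := by
    simp only [quadForm, testWeight, div_mul_eq_mul_div, tsum_div_const]
  rw [normStat, testStat, hquad, Real.coe_toNNReal _ (sq_nonneg ε)]
  field_simp

theorem mgf_normStat_mem_Icc (hφ : Orthonormal ℝ φ) (S : Signal) (ht : |t| * b ≤ 1 / 4) :
    mgf (normStat κ ε) (observationLaw φ ε S) t ∈
      Set.Icc
        (Real.exp (t * BCoef φ κ ε S + t ^ 2 / 2 - 4 * t ^ 2 * b * (|t| + BCoef φ κ ε S)))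
        (Real.exp (t * BCoef φ κ ε S + t ^ 2 / 2 + 4 * t ^ 2 * b * (|t| + BCoef φ κ ε S))) := by
  have hε := h.noise_pos
  have hvar : ((ε ^ 2).toNNReal : ℝ) ^ 2 * (1 / (2 * ε ^ 4)) = 1 / 2 := by
    rw [Real.coe_toNNReal _ (sq_nonneg ε)]
    field_simp
  have hlog := abs_log_mgf_quadForm_sub_le (testWeight_nonneg κ ε) h.hasSum_testWeight
    (h.hasSum_testWeight_mul_fourierCoef_sq hφ S) h.hasSum_testWeight_sq h.testWeight_mul_le ht
  have hpos := mgf_pos (integrable_exp_mul_quadForm (testWeight_nonneg κ ε) h.hasSum_testWeight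
    (h.hasSum_testWeight_mul_fourierCoef_sq hφ S) h.hasSum_testWeight_sq h.testWeight_mul_le ht)
  have hcentre : mgf (normStat κ ε) (observationLaw φ ε S) t =
      Real.exp (-(t * ((ε ^ 2).toNNReal * (rhoSq κ ε / (ε ^ 4 * √(2 * ACoef κ ε)))))) *
        mgf (quadForm (testWeight κ ε)) (gaussianProduct (fourierCoef φ S) (ε ^ 2).toNNReal) t := by
    simp only [mgf, ← integral_const_mul, ← Real.exp_add, h.normStat_eq]
    congr with y
    ring_nf
  rw [hvar, abs_le] at hlog
  rw [hcentre, ← Real.exp_log hpos, ← Real.exp_add, Set.mem_Icc, Real.exp_le_exp, Real.exp_le_exp]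
  constructor <;> linarith

theorem integrable_exp_mul_normStat (hφ : Orthonormal ℝ φ) (S : Signal) (ht : |t| * b ≤ 1 / 4) :
    Integrable (fun y => Real.exp (t * normStat κ ε y)) (observationLaw φ ε S) :=
  integrable_exp_mul_of_mgf_mem_Icc (h.mgf_normStat_mem_Icc hφ S ht)

theorem mgf_bCoef_sub_normStat_mem_Icc (hφ : Orthonormal ℝ φ) (S : Signal)
    (ht : |t| * b ≤ 1 / 4) :
    mgf (fun y => BCoef φ κ ε S - normStat κ ε y) (observationLaw φ ε S) t ∈ Set.Icc
      (Real.exp (t ^ 2 / 2 - 4 * t ^ 2 * b * (|t| + BCoef φ κ ε S)))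
      (Real.exp (t ^ 2 / 2 + 4 * t ^ 2 * b * (|t| + BCoef φ κ ε S))) := by
  have hcentre : mgf (fun y => BCoef φ κ ε S - normStat κ ε y) (observationLaw φ ε S) t =
      Real.exp (t * BCoef φ κ ε S) * mgf (normStat κ ε) (observationLaw φ ε S) (-t) := by
    rw [← mgf_neg, ← mgf_const_add]
    simp only [sub_eq_add_neg, Pi.neg_apply]
  have hmgf := h.mgf_normStat_mem_Icc hφ S (t := -t) (by rwa [abs_neg])
  rw [abs_neg, neg_sq] at hmgf
  rw [hcentre]
  refine ⟨le_trans ?_ (mul_le_mul_of_nonneg_left hmgf.1 (Real.exp_pos _).le),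
    (mul_le_mul_of_nonneg_left hmgf.2 (Real.exp_pos _).le).trans ?_⟩ <;>
  · rw [← Real.exp_add, Real.exp_le_exp]
    linarith

theorem typeI_le_exp (hφ : Orthonormal ℝ φ) (ht : 0 ≤ t) (htx : t ≤ x) (hb : 16 * (b * t) ≤ 1) :
    typeI φ κ ε x ≤ Real.exp (-(t ^ 2 / 4)) := by
  have hsmall : |t| * b ≤ 1 / 4 := by rw [abs_of_nonneg ht]; linarith
  have hmgf := (h.mgf_normStat_mem_Icc hφ 0 hsmall).2
  rw [bCoef_zero, abs_of_nonneg ht] at hmgf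
  calc typeI φ κ ε x ≤ (observationLaw φ ε 0).real {y | x ≤ normStat κ ε y} :=
        measureReal_mono (Set.ofPred_subset_ofPred.2 fun _ => le_of_lt)
    _ ≤ Real.exp (-t * x) * Real.exp (t * 0 + t ^ 2 / 2 + 4 * t ^ 2 * b * (t + 0)) :=
        (measure_ge_le_exp_mul_mgf x ht (h.integrable_exp_mul_normStat hφ 0 hsmall)).trans
          (mul_le_mul_of_nonneg_left hmgf (Real.exp_pos _).le)
    _ ≤ Real.exp (-(t ^ 2 / 4)) := by
        rw [← Real.exp_add, Real.exp_le_exp]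
        nlinarith [mul_le_mul_of_nonneg_left htx ht, mul_le_mul_of_nonneg_left hb (sq_nonneg t)]

theorem typeII_le_exp (hφ : Orthonormal ℝ φ) (ht : 0 ≤ t) (htx : t ≤ BCoef φ κ ε S - x)
    (hb : 16 * (b * (t + BCoef φ κ ε S)) ≤ 1) :
    typeII φ κ ε x S ≤ Real.exp (-(t ^ 2 / 4)) := by
  have hbB := mul_nonneg h.bound_nonneg (bCoef_nonneg φ κ ε S)
  have hsmall : |-t| * b ≤ 1 / 4 := by rw [abs_neg, abs_of_nonneg ht]; linarith
  have hmgf := (h.mgf_normStat_mem_Icc hφ S hsmall).2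
  rw [abs_neg, abs_of_nonneg ht] at hmgf
  calc typeII φ κ ε x S = (observationLaw φ ε S).real {y | normStat κ ε y ≤ x} := by
        rw [typeII_eq_measureReal_normStat_le]
    _ ≤ Real.exp (-(-t) * x) * Real.exp (-t * BCoef φ κ ε S + (-t) ^ 2 / 2 +
          4 * (-t) ^ 2 * b * (t + BCoef φ κ ε S)) :=
        (measure_le_le_exp_mul_mgf x (neg_nonpos.2 ht)
          (h.integrable_exp_mul_normStat hφ S hsmall)).trans
          (mul_le_mul_of_nonneg_left hmgf (Real.exp_pos _).le)
    _ ≤ Real.exp (-(t ^ 2 / 4)) := by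
        rw [← Real.exp_add, Real.exp_le_exp]
        nlinarith [mul_le_mul_of_nonneg_left htx ht, mul_le_mul_of_nonneg_left hb (sq_nonneg t)]

end WeightBound
end NormalisedStatistic

section ErrorProbabilities

variable {φ : ℕ → Signal} {κ : ℝ → ℕ → ℝ} {ε x : ℝ} {S S' : Signal}

theorem measurableSet_rejectionRegion (κ : ℝ → ℕ → ℝ) (ε x : ℝ) :
    MeasurableSet (rejectionRegion κ ε x) :=
  measurableSet_lt measurable_const (measurable_normStat κ ε)

theorem typeII_zero (φ : ℕ → Signal) (κ : ℝ → ℕ → ℝ) (ε x : ℝ) :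
    typeII φ κ ε x 0 = 1 - typeI φ κ ε x :=
  probReal_compl_eq_one_sub (measurableSet_rejectionRegion κ ε x)

theorem neg_log_typeII_nonneg : 0 ≤ -Real.log (typeII φ κ ε x S) :=
  neg_nonneg.2 (Real.log_nonpos measureReal_nonneg measureReal_le_one)

theorem sum_fourierCoef_sub_sq_le (hφ : Orthonormal ℝ φ) (S S' : Signal) (s : Finset ℕ) :
    ∑ i ∈ s, (fourierCoef φ S' i - fourierCoef φ S i) ^ 2 ≤ ‖S' - S‖ ^ 2 := by
  have hbessel := hφ.sum_inner_products_le (S' - S) (s := s)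
  simpa only [fourierCoef, ← inner_sub_right, Real.norm_eq_abs, sq_abs] using hbessel

theorem typeII_le_rpow (hφ : Orthonormal ℝ φ) (hε : ε ≠ 0) {p q : ℝ} (hpq : p.HolderConjugate q) :
    typeII φ κ ε x S' ≤ Real.exp ((q - 1) * (‖S' - S‖ ^ 2 / (2 * ε ^ 2))) *
      typeII φ κ ε x S ^ (1 / p) := by
  have hv : (ε ^ 2).toNNReal ≠ 0 := (Real.toNNReal_pos.2 (by positivity)).ne'
  have hshift := gaussianProduct_shift_le hv hpq (sum_fourierCoef_sub_sq_le hφ S S')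
    (measurableSet_rejectionRegion κ ε x).compl
  rwa [Real.coe_toNNReal _ (sq_nonneg ε)] at hshift

theorem typeII_pos (hφ : Orthonormal ℝ φ) (hε : ε ≠ 0) (hx : typeI φ κ ε x < 1) (S : Signal) :
    0 < typeII φ κ ε x S := by
  have hzero : 0 < typeII φ κ ε x 0 := by rw [typeII_zero]; linarith
  refine measureReal_nonneg.lt_of_ne fun hS => hzero.not_ge ?_
  have hpq : (2 : ℝ).HolderConjugate 2 := Real.HolderConjugate.two_two
  refine (typeII_le_rpow (S := S) hφ hε hpq).trans_eq ?_
  rw [show typeII φ κ ε x S = 0 from hS.symm, Real.zero_rpow (by norm_num), mul_zero]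

theorem neg_log_typeII_le_add (hφ : Orthonormal ℝ φ) (hε : ε ≠ 0) {p q : ℝ}
    (hpq : p.HolderConjugate q) (hx : typeI φ κ ε x < 1) (S S' : Signal) :
    -Real.log (typeII φ κ ε x S) ≤
      p * -Real.log (typeII φ κ ε x S') + q * (‖S' - S‖ ^ 2 / (2 * ε ^ 2)) := by
  have hS := typeII_pos hφ hε hx S
  have hlog := Real.log_le_log (typeII_pos hφ hε hx S')
    (typeII_le_rpow (κ := κ) (x := x) (S := S) (S' := S') hφ hε hpq)
  rw [Real.log_mul (Real.exp_pos _).ne' (Real.rpow_pos_of_pos hS _).ne', Real.log_exp,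
    Real.log_rpow hS] at hlog
  have hscaled := mul_le_mul_of_nonneg_left hlog hpq.nonneg
  rw [mul_add, ← mul_assoc, ← mul_assoc, mul_one_div_cancel hpq.ne_zero, one_mul, mul_sub_one,
    hpq.mul_eq_add, add_sub_cancel_left] at hscaled
  linarith

end ErrorProbabilities

theorem neg_log_typeII_isEquivalent {φ : ℕ → Signal} {κ : ℝ → ℕ → ℝ} (hφ : Orthonormal ℝ φ)
    {l : Filter ℝ} {b x : ℝ → ℝ} {S : ℝ → Signal} (hκ : ∀ᶠ ε in l, WeightBound κ ε (b ε))
    (hgap : Tendsto (fun ε => BCoef φ κ ε (S ε) - x ε) l atTop)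
    (hb : Tendsto (fun ε => b ε * (BCoef φ κ ε (S ε) - x ε)) l (𝓝 0))
    (hB : Tendsto (fun ε => b ε * BCoef φ κ ε (S ε)) l (𝓝 0)) :
    (fun ε => -Real.log (typeII φ κ ε (x ε) (S ε))) ~[l]
      fun ε => (BCoef φ κ ε (S ε) - x ε) ^ 2 / 2 := by
  have htail : ∀ ε, typeII φ κ ε (x ε) (S ε) = (observationLaw φ ε (S ε)).real
      {y | BCoef φ κ ε (S ε) - x ε ≤ BCoef φ κ ε (S ε) - normStat κ ε y} := fun ε => by
    rw [typeII_eq_measureReal_normStat_le]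
    simp only [sub_le_sub_iff_left]
  simp_rw [htail]
  refine neg_log_measureReal_ge_isEquivalent (Y := fun ε y => BCoef φ κ ε (S ε) - normStat κ ε y)
    (fun ε => measurable_const.sub (measurable_normStat κ ε)) hgap fun η hη => ?_
  filter_upwards [hκ, hgap.eventually_ge_atTop 0,
    hb.eventually_le_const (by norm_num : (0 : ℝ) < 1 / 12),
    (((hb.const_mul 3).add hB).const_mul 36).eventually_le_const (by simpa using hη)]
    with ε hκε hτ hbτ herr t ht
  set τ := BCoef φ κ ε (S ε) - x ε
  have hb₀ := hκε.bound_nonneg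
  have ht₀ : 0 ≤ t := hτ.trans ht.1
  have hB₀ := bCoef_nonneg φ κ ε (S ε)
  have hmgf := hκε.mgf_bCoef_sub_normStat_mem_Icc hφ (S ε) (t := t) (by
    rw [abs_of_nonneg ht₀]
    nlinarith [ht.2])
  rw [abs_of_nonneg ht₀] at hmgf
  have herror : 4 * t ^ 2 * b ε * (t + BCoef φ κ ε (S ε)) ≤ η * τ ^ 2 := by
    calc 4 * t ^ 2 * b ε * (t + BCoef φ κ ε (S ε))
        ≤ 4 * (3 * τ) ^ 2 * b ε * (3 * τ + BCoef φ κ ε (S ε)) := by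
          have := ht.2
          gcongr
      _ = 36 * (3 * (b ε * τ) + b ε * BCoef φ κ ε (S ε)) * τ ^ 2 := by ring
      _ ≤ η * τ ^ 2 := mul_le_mul_of_nonneg_right herr (sq_nonneg τ)
  exact Set.Icc_subset_Icc (Real.exp_le_exp.2 (by linarith)) (Real.exp_le_exp.2 (by linarith)) hmgf

namespace WeightBound

variable {φ : ℕ → Signal} {κ : ℝ → ℕ → ℝ} {ε b : ℝ}

theorem bCoef_le (h : WeightBound κ ε b) (hφ : Orthonormal ℝ φ) (S : Signal) :
    BCoef φ κ ε S ≤ b * (‖S‖ / ε) ^ 2 := by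
  have hε := h.noise_pos
  have hweight : ∀ i, testWeight κ ε i ≤ b / ε ^ 2 := fun i => by
    rw [le_div_iff₀ (by positivity)]
    simpa only [Real.coe_toNNReal _ (sq_nonneg ε)] using h.testWeight_mul_le i
  refine hasSum_le_of_sum_le (h.hasSum_testWeight_mul_fourierCoef_sq hφ S) fun s => ?_
  have hbessel : ∑ i ∈ s, fourierCoef φ S i ^ 2 ≤ ‖S‖ ^ 2 := by
    simpa [fourierCoef] using sum_fourierCoef_sub_sq_le hφ 0 S s
  calc ∑ i ∈ s, testWeight κ ε i * fourierCoef φ S i ^ 2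
      ≤ ∑ i ∈ s, b / ε ^ 2 * fourierCoef φ S i ^ 2 :=
        Finset.sum_le_sum fun i _ => mul_le_mul_of_nonneg_right (hweight i) (sq_nonneg _)
    _ = b / ε ^ 2 * ∑ i ∈ s, fourierCoef φ S i ^ 2 := (Finset.mul_sum ..).symm
    _ ≤ b / ε ^ 2 * ‖S‖ ^ 2 :=
        mul_le_mul_of_nonneg_left hbessel (div_nonneg h.bound_nonneg (sq_nonneg ε))
    _ = b * (‖S‖ / ε) ^ 2 := by ring

theorem abs_bCoef_add_sub_le (h : WeightBound κ ε b) (hφ : Orthonormal ℝ φ) (S S' : Signal)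
    {η : ℝ} (hη : 0 < η) :
    |BCoef φ κ ε (S + S') - BCoef φ κ ε S| ≤
      η * BCoef φ κ ε S + (1 + η⁻¹) * BCoef φ κ ε S' := by
  have hsum := fun S => h.hasSum_testWeight_mul_fourierCoef_sq hφ S
  have hdiff := (hsum (S + S')).sub (hsum S)
  have hbound := ((hsum S).mul_left η).add ((hsum S').mul_left (1 + η⁻¹))
  have hterm : ∀ i, |testWeight κ ε i * fourierCoef φ (S + S') i ^ 2 -
      testWeight κ ε i * fourierCoef φ S i ^ 2| ≤ η * (testWeight κ ε i * fourierCoef φ S i ^ 2) +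
        (1 + η⁻¹) * (testWeight κ ε i * fourierCoef φ S' i ^ 2) := fun i => by
    have hyoung : ∀ a d : ℝ, |(a + d) ^ 2 - a ^ 2| ≤ η * a ^ 2 + (1 + η⁻¹) * d ^ 2 := fun a d => by
      have hplus : 0 ≤ η * (a + η⁻¹ * d) ^ 2 := by positivity
      have hminus : 0 ≤ η * (a - η⁻¹ * d) ^ 2 := by positivity
      have hexpand : ∀ σ : ℝ, η * (a + σ * (η⁻¹ * d)) ^ 2 =
          η * a ^ 2 + 2 * σ * (a * d) + σ ^ 2 * (η⁻¹ * d ^ 2) := fun σ => by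
        field_simp
        ring
      rw [abs_le]
      constructor <;> nlinarith [hexpand 1, hexpand (-1), sq_nonneg d]
    have hadd : fourierCoef φ (S + S') i = fourierCoef φ S i + fourierCoef φ S' i :=
      inner_add_right ..
    have hscaled := mul_le_mul_of_nonneg_left (hyoung (fourierCoef φ S i) (fourierCoef φ S' i))
      (testWeight_nonneg κ ε i)
    rw [hadd, ← mul_sub, abs_mul, abs_of_nonneg (testWeight_nonneg κ ε i)]
    exact hscaled.trans_eq (by ring)
  exact abs_le.2 ⟨neg_le.1 (hasSum_le (fun i => neg_le.1 (abs_le.1 (hterm i)).1) hdiff.neg hbound),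
    hasSum_le (fun i => (abs_le.1 (hterm i)).2) hdiff hbound⟩

end WeightBound

section Consistency

variable {φ : ℕ → Signal} {κ : ℝ → ℕ → ℝ} {l : Filter ℝ} {b rate x : ℝ → ℝ} {S : ℝ → Signal}

theorem tendsto_mul_bCoef (hφ : Orthonormal ℝ φ) (hκ : ∀ᶠ ε in l, WeightBound κ ε (b ε))
    (hS : Tendsto (fun ε => b ε * (‖S ε‖ / ε)) l (𝓝 0)) :
    Tendsto (fun ε => b ε * BCoef φ κ ε (S ε)) l (𝓝 0) := by
  refine squeeze_zero' (hκ.mono fun ε h => mul_nonneg h.bound_nonneg (bCoef_nonneg φ κ ε (S ε)))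
    (hκ.mono fun ε h => ?_) (by simpa using hS.pow 2)
  calc b ε * BCoef φ κ ε (S ε) ≤ b ε * (b ε * (‖S ε‖ / ε) ^ 2) :=
        mul_le_mul_of_nonneg_left (h.bCoef_le hφ (S ε)) h.bound_nonneg
    _ = (b ε * (‖S ε‖ / ε)) ^ 2 := by ring

theorem tendsto_typeII_zero (hφ : Orthonormal ℝ φ) (hκ : ∀ᶠ ε in l, WeightBound κ ε (b ε))
    (hx : Tendsto x l atBot) (hb : Tendsto (fun ε => b ε * x ε) l (𝓝 0)) :
    Tendsto (fun ε => typeII φ κ ε (x ε) 0) l (𝓝[>] 0) := by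
  have hlog : Tendsto (fun ε => -Real.log (typeII φ κ ε (x ε) 0)) l atTop := by
    refine (neg_log_typeII_isEquivalent hφ hκ (S := fun _ => 0) ?_ ?_ ?_).symm.tendsto_atTop ?_ <;>
      simp only [bCoef_zero, zero_sub, mul_neg, mul_zero, neg_sq]
    · exact tendsto_neg_atBot_atTop.comp hx
    · simpa using hb.neg
    · exact tendsto_const_nhds
    · exact ((tendsto_pow_atTop two_ne_zero).comp
        (tendsto_neg_atBot_atTop.comp hx)).atTop_div_const two_pos |>.congr fun ε => by simp
  have hpos : ∀ᶠ ε in l, 0 < typeII φ κ ε (x ε) 0 := by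
    filter_upwards [hlog.eventually_gt_atTop 0] with ε hε
    refine measureReal_nonneg.lt_of_ne fun h => ?_
    rw [show typeII φ κ ε (x ε) 0 = 0 from h.symm, Real.log_zero, neg_zero] at hε
    exact lt_irrefl 0 hε
  refine tendsto_nhdsWithin_iff.2 ⟨(Real.tendsto_exp_neg_atTop_nhds_zero.comp hlog).congr' ?_, hpos⟩
  filter_upwards [hpos] with ε hε
  rw [Function.comp_apply, neg_neg, Real.exp_log hε]

theorem isTestFamily_of_tendsto_atBot (hφ : Orthonormal ℝ φ)
    (hκ : ∀ᶠ ε in l, WeightBound κ ε (b ε)) (hx : Tendsto x l atBot)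
    (hb : Tendsto (fun ε => b ε * x ε) l (𝓝 0)) : IsTestFamily φ κ l x := by
  have hnull := tendsto_typeII_zero hφ hκ hx hb
  filter_upwards [hnull.eventually self_mem_nhdsWithin,
    (tendsto_nhds_of_tendsto_nhdsWithin hnull).eventually_lt_const one_pos] with ε hpos hlt
  rw [typeII_zero] at hpos
  rw [typeII_zero] at hlt
  constructor <;> linarith

theorem logLevelNegligible_of_tendsto_atBot (hφ : Orthonormal ℝ φ)
    (hκ : ∀ᶠ ε in l, WeightBound κ ε (b ε)) (hrate : Tendsto rate l atTop)
    (hx : Tendsto x l atBot) (hb : Tendsto (fun ε => b ε * x ε) l (𝓝 0)) :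
    LogLevelNegligible φ κ l rate x := by
  have hnull := tendsto_nhds_of_tendsto_nhdsWithin (tendsto_typeII_zero hφ hκ hx hb)
  have hlevel : Tendsto (fun ε => typeI φ κ ε (x ε)) l (𝓝 1) := by
    simpa only [typeII_zero, sub_sub_cancel, sub_zero] using hnull.const_sub 1
  have hinv : Tendsto (fun ε => (rate ε ^ 2)⁻¹) l (𝓝 0) :=
    ((tendsto_pow_atTop two_ne_zero).comp hrate).inv_tendsto_atTop
  simpa [LogLevelNegligible] using hinv.mul (hlevel.log one_ne_zero)

theorem eventually_rate_le_bCoef_of_ldConsistentAlong (hφ : Orthonormal ℝ φ)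
    (hκ : ∀ᶠ ε in l, WeightBound κ ε (b ε)) (hrate : Tendsto rate l atTop)
    (hb : Tendsto (fun ε => b ε * rate ε) l (𝓝 0))
    (hB : Tendsto (fun ε => b ε * BCoef φ κ ε (S ε)) l (𝓝 0))
    (hcons : LDConsistentAlong φ κ l rate S) :
    ∃ c > 0, ∀ᶠ ε in l, c * rate ε ≤ BCoef φ κ ε (S ε) := by
  have hsqrt : Tendsto (fun ε => √(rate ε)) l atTop := Real.tendsto_sqrt_atTop.comp hrate
  have hbsqrt : Tendsto (fun ε => b ε * √(rate ε)) l (𝓝 0) := by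
    refine squeeze_zero' (hκ.mono fun ε h => mul_nonneg h.bound_nonneg (Real.sqrt_nonneg _)) ?_ hb
    filter_upwards [hκ, hrate.eventually_ge_atTop 1] with ε h hε
    exact mul_le_mul_of_nonneg_left (Real.sqrt_le_self_iff.2 (.inr hε)) h.bound_nonneg
  have hx : Tendsto (fun ε => -√(rate ε)) l atBot := tendsto_neg_atTop_atBot.comp hsqrt
  have hbx : Tendsto (fun ε => b ε * -√(rate ε)) l (𝓝 0) := by simpa using hbsqrt.neg
  obtain ⟨c, hc, hpower⟩ := hcons _ (isTestFamily_of_tendsto_atBot hφ hκ hx hbx)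
    (logLevelNegligible_of_tendsto_atBot hφ hκ hrate hx hbx)
  have hequiv := neg_log_typeII_isEquivalent (x := fun ε => -√(rate ε)) (S := S) hφ hκ
    (tendsto_atTop_mono (fun ε => by
      have := bCoef_nonneg φ κ ε (S ε)
      linarith) hsqrt)
    (by simpa [mul_add] using hB.add hbsqrt) hB
  refine ⟨√c / 2, by positivity, ?_⟩
  filter_upwards [hpower, hequiv.isLittleO.def one_pos, hsqrt.eventually_ge_atTop (2 / √c),
    hrate.eventually_ge_atTop 0] with ε hpow hupper hlarge hrateε
  have hB₀ := bCoef_nonneg φ κ ε (S ε)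
  have hsq : (√c * rate ε) ^ 2 ≤ (BCoef φ κ ε (S ε) + √(rate ε)) ^ 2 := by
    rw [mul_pow, Real.sq_sqrt hc.le]
    simp only [Pi.sub_apply, Real.norm_eq_abs, one_mul, sub_neg_eq_add] at hupper
    rw [abs_of_nonneg (a := _ / 2) (by positivity)] at hupper
    rw [abs_of_nonpos (neg_nonneg.1 neg_log_typeII_nonneg)] at hpow
    linarith [(abs_le.1 hupper).2]
  have hlin := abs_le_of_sq_le_sq hsq (by positivity)
  have hroot : √(rate ε) ≤ √c / 2 * rate ε := by
    rw [div_le_iff₀ (by positivity)] at hlarge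
    have := mul_le_mul_of_nonneg_left hlarge (Real.sqrt_nonneg (rate ε))
    rw [← mul_assoc, Real.mul_self_sqrt hrateε] at this
    linarith
  linarith [le_abs_self (√c * rate ε)]

theorem eventually_le_mul_rate_of_logLevelNegligible (hφ : Orthonormal ℝ φ)
    (hκ : ∀ᶠ ε in l, WeightBound κ ε (b ε)) (hrate : Tendsto rate l atTop)
    (hb : Tendsto (fun ε => b ε * rate ε) l (𝓝 0)) (hx : IsTestFamily φ κ l x)
    (hlevel : LogLevelNegligible φ κ l rate x) {η : ℝ} (hη : 0 < η) :
    ∀ᶠ ε in l, x ε ≤ η * rate ε := by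
  have hsmall : Tendsto (fun ε => 16 * (b ε * (η * rate ε))) l (𝓝 0) := by
    simpa [mul_left_comm] using (hb.const_mul η).const_mul 16
  filter_upwards [hκ, hx, hrate.eventually_gt_atTop 0, hsmall.eventually_le_const one_pos,
    hlevel.eventually_const_lt (by simpa using sq_pos_of_pos hη : -(η ^ 2 / 4) < 0)]
    with ε hκε hxε hrateε hbε hlog
  by_contra! hlt
  have hlogle := Real.log_le_log hxε.1 (hκε.typeI_le_exp hφ (by positivity) hlt.le hbε)
  rw [Real.log_exp] at hlogle
  rw [inv_mul_eq_div, lt_div_iff₀ (by positivity)] at hlog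
  linarith

theorem ldConsistentAlong_of_eventually_rate_le_bCoef (hφ : Orthonormal ℝ φ)
    (hκ : ∀ᶠ ε in l, WeightBound κ ε (b ε)) (hrate : Tendsto rate l atTop)
    (hb : Tendsto (fun ε => b ε * rate ε) l (𝓝 0))
    (hB : Tendsto (fun ε => b ε * BCoef φ κ ε (S ε)) l (𝓝 0)) {c : ℝ} (hc : 0 < c)
    (hle : ∀ᶠ ε in l, c * rate ε ≤ BCoef φ κ ε (S ε)) : LDConsistentAlong φ κ l rate S := by
  intro x hx hlevel
  refine ⟨c ^ 2 / 16, by positivity, ?_⟩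
  have hsmall : Tendsto (fun ε => 16 * (b ε * (c / 2 * rate ε + BCoef φ κ ε (S ε)))) l (𝓝 0) := by
    simpa [mul_add, mul_left_comm] using ((hb.const_mul (c / 2)).add hB).const_mul 16
  filter_upwards [hκ, hx, hle, hrate.eventually_gt_atTop 0, hsmall.eventually_le_const one_pos,
    eventually_le_mul_rate_of_logLevelNegligible hφ hκ hrate hb hx hlevel (half_pos hc)]
    with ε hκε hxε hleε hrateε hbε hthreshold
  have hlog := Real.log_le_log (typeII_pos hφ hκε.noise_pos.ne' hxε.2 (S ε))
    (hκε.typeII_le_exp hφ (t := c / 2 * rate ε) (by positivity) (by linarith) hbε)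
  rw [Real.log_exp] at hlog
  rw [abs_of_nonpos (neg_nonneg.1 neg_log_typeII_nonneg)]
  linarith

theorem bCoef_isLittleO_of_ldInconsistent (hφ : Orthonormal ℝ φ)
    (hκ : ∀ᶠ ε in 𝓝[>] 0, WeightBound κ ε (b ε)) (hrate : Tendsto rate (𝓝[>] 0) atTop)
    (hb : Tendsto (fun ε => b ε * rate ε) (𝓝[>] 0) (𝓝 0))
    (hB : Tendsto (fun ε => b ε * BCoef φ κ ε (S ε)) (𝓝[>] 0) (𝓝 0))
    (hincons : LDInconsistent φ κ rate S) :
    (fun ε => BCoef φ κ ε (S ε)) =o[𝓝[>] 0] rate := by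
  refine isLittleO_iff.2 fun c hc => ?_
  by_contra hnot
  obtain ⟨u, hu, hlarge⟩ := exists_seq_forall_of_frequently (not_eventually.1 hnot)
  have hmap : map u atTop ≤ 𝓝[>] 0 := hu
  refine hincons u hu (ldConsistentAlong_of_eventually_rate_le_bCoef hφ (hmap hκ)
    (hrate.mono_left hmap) (hb.mono_left hmap) (hB.mono_left hmap) hc
    (eventually_map.2 (.of_forall fun n => ?_)))
  have hn := (not_le.1 (hlarge n)).le
  rw [Real.norm_of_nonneg (bCoef_nonneg φ κ _ _)] at hn
  exact (mul_le_mul_of_nonneg_left (le_abs_self _) hc.le).trans hn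

end Consistency

theorem isEquivalent_of_le_mul_add {ι : Type*} {l : Filter ι} {f g e : ι → ℝ} (hg : 0 ≤ᶠ[l] g)
    (hfg : ∀ p q : ℝ, p.HolderConjugate q → ∀ᶠ i in l, f i ≤ p * g i + q * e i)
    (hgf : ∀ p q : ℝ, p.HolderConjugate q → ∀ᶠ i in l, g i ≤ p * f i + q * e i)
    (he : e =o[l] g) : f ~[l] g := by
  refine isLittleO_iff.2 fun c hc => ?_
  have hpq : (1 + c / 2).HolderConjugate (Real.conjExponent (1 + c / 2)) :=
    .conjExponent (by linarith)
  set q := Real.conjExponent (1 + c / 2)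
  filter_upwards [hg, hfg _ q hpq, hgf _ q hpq, he.def (c := c / (2 * q)) (div_pos hc (by
    linarith [hpq.symm.pos]))] with i hgi hfgi hgfi hei
  have hgi₀ : 0 ≤ g i := hgi
  have herror : q * e i ≤ c / 2 * g i := by
    rw [Real.norm_of_nonneg hgi₀] at hei
    have := mul_le_mul_of_nonneg_left ((le_abs_self _).trans hei) hpq.symm.nonneg
    have hq := hpq.symm.ne_zero
    refine this.trans_eq (by field_simp)
  rw [Pi.sub_apply, Real.norm_eq_abs, Real.norm_of_nonneg hgi₀, abs_le]
  constructor <;> nlinarith [mul_nonneg hc.le hgi₀]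

section Comparison

variable {φ : ℕ → Signal} {κ : ℝ → ℕ → ℝ} {l : Filter ℝ} {b x : ℝ → ℝ} {S S₁ : ℝ → Signal}

theorem gap_add_isEquivalent (hφ : Orthonormal ℝ φ) (hκ : ∀ᶠ ε in l, WeightBound κ ε (b ε))
    (hS : (fun ε => BCoef φ κ ε (S ε)) =O[l] fun ε => BCoef φ κ ε (S ε) - x ε)
    (hS₁ : (fun ε => BCoef φ κ ε (S₁ ε)) =o[l] fun ε => BCoef φ κ ε (S ε) - x ε) :
    (fun ε => BCoef φ κ ε (S ε + S₁ ε) - x ε) ~[l] fun ε => BCoef φ κ ε (S ε) - x ε := by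
  obtain ⟨K, hK, hSK⟩ := hS.exists_pos
  refine isLittleO_iff.2 fun c hc => ?_
  set η := c / (2 * K)
  have hη : 0 < η := by positivity
  filter_upwards [hκ, hSK.bound, hS₁.def (c := c / (2 * (1 + η⁻¹))) (by positivity)]
    with ε hκε hSε hS₁ε
  rw [Real.norm_of_nonneg (bCoef_nonneg φ κ ε _)] at hSε hS₁ε
  rw [Pi.sub_apply, sub_sub_sub_cancel_right, Real.norm_eq_abs]
  calc |BCoef φ κ ε (S ε + S₁ ε) - BCoef φ κ ε (S ε)|
      ≤ η * BCoef φ κ ε (S ε) + (1 + η⁻¹) * BCoef φ κ ε (S₁ ε) :=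
        hκε.abs_bCoef_add_sub_le hφ _ _ hη
    _ ≤ η * (K * ‖BCoef φ κ ε (S ε) - x ε‖) +
          (1 + η⁻¹) * (c / (2 * (1 + η⁻¹)) * ‖BCoef φ κ ε (S ε) - x ε‖) := by gcongr
    _ = c * ‖BCoef φ κ ε (S ε) - x ε‖ := by
        have : 1 + η⁻¹ ≠ 0 := by positivity
        simp only [η] at this ⊢
        field_simp
        ring

theorem neg_log_typeII_add_isEquivalent_of_tendsto_mul_gap (hφ : Orthonormal ℝ φ)
    (hκ : ∀ᶠ ε in l, WeightBound κ ε (b ε))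
    (hB : Tendsto (fun ε => b ε * BCoef φ κ ε (S ε)) l (𝓝 0))
    (hgap : Tendsto (fun ε => BCoef φ κ ε (S ε) - x ε) l atTop)
    (hS : (fun ε => BCoef φ κ ε (S ε)) =O[l] fun ε => BCoef φ κ ε (S ε) - x ε)
    (hS₁ : (fun ε => BCoef φ κ ε (S₁ ε)) =o[l] fun ε => BCoef φ κ ε (S ε) - x ε)
    (hb : Tendsto (fun ε => b ε * (BCoef φ κ ε (S ε) - x ε)) l (𝓝 0)) :
    (fun ε => -Real.log (typeII φ κ ε (x ε) (S ε + S₁ ε))) ~[l]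
      fun ε => -Real.log (typeII φ κ ε (x ε) (S ε)) := by
  have hgaps := gap_add_isEquivalent hφ hκ hS hS₁
  have hb' : Tendsto (fun ε => b ε * (BCoef φ κ ε (S ε + S₁ ε) - x ε)) l (𝓝 0) :=
    ((isBigO_refl b l).mul hgaps.isBigO).trans_tendsto hb
  have hB' : Tendsto (fun ε => b ε * BCoef φ κ ε (S ε + S₁ ε)) l (𝓝 0) := by
    have := (hb'.sub hb).add hB
    simp only [sub_zero, add_zero] at this
    exact this.congr fun ε => by ring
  have hsq := (hgaps.pow 2).div (IsEquivalent.refl (u := fun _ => (2 : ℝ)))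
  exact (neg_log_typeII_isEquivalent (S := fun ε => S ε + S₁ ε) hφ hκ
    (hgaps.symm.tendsto_atTop hgap) hb' hB').trans
      (hsq.trans (neg_log_typeII_isEquivalent hφ hκ hgap hb hB).symm)

theorem neg_log_typeII_add_isEquivalent_of_norm_sq_isLittleO (hφ : Orthonormal ℝ φ)
    (hκ : ∀ᶠ ε in l, WeightBound κ ε (b ε)) (hx : ∀ᶠ ε in l, typeI φ κ ε (x ε) < 1)
    (hS₁ : (fun ε => (‖S₁ ε‖ / ε) ^ 2) =o[l] fun ε => -Real.log (typeII φ κ ε (x ε) (S ε))) :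
    (fun ε => -Real.log (typeII φ κ ε (x ε) (S ε + S₁ ε))) ~[l]
      fun ε => -Real.log (typeII φ κ ε (x ε) (S ε)) := by
  refine isEquivalent_of_le_mul_add (e := fun ε => (‖S₁ ε‖ / ε) ^ 2 / 2)
    (.of_forall fun ε => neg_log_typeII_nonneg) (fun p q hpq => ?_) (fun p q hpq => ?_) ?_
  · filter_upwards [hκ, hx] with ε hκε hxε
    refine (neg_log_typeII_le_add hφ hκε.noise_pos.ne' hpq hxε _ (S ε)).trans_eq ?_
    rw [sub_add_cancel_left, norm_neg]
    ring
  · filter_upwards [hκ, hx] with ε hκε hxε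
    refine (neg_log_typeII_le_add hφ hκε.noise_pos.ne' hpq hxε _ (S ε + S₁ ε)).trans_eq ?_
    rw [add_sub_cancel_left]
    ring
  · simpa only [div_eq_inv_mul] using hS₁.const_mul_left (2 : ℝ)⁻¹

theorem norm_sq_isLittleO_neg_log_typeII (hφ : Orthonormal ℝ φ)
    (hκ : ∀ᶠ ε in l, WeightBound κ ε (b ε)) (hx : ∀ᶠ ε in l, typeI φ κ ε (x ε) < 1)
    (hB : Tendsto (fun ε => b ε * BCoef φ κ ε (S ε)) l (𝓝 0))
    (hnorm : Tendsto (fun ε => b ε * (‖S₁ ε‖ / ε)) l (𝓝 0))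
    (hgap : ∀ᶠ ε in l, 0 ≤ BCoef φ κ ε (S ε) - x ε)
    (hlarge : ∀ᶠ ε in l, ‖S₁ ε‖ / ε < b ε * (BCoef φ κ ε (S ε) - x ε) ^ 2) :
    (fun ε => (‖S₁ ε‖ / ε) ^ 2) =o[l] fun ε => -Real.log (typeII φ κ ε (x ε) (S ε)) := by
  refine isLittleO_iff.2 fun c hc => ?_
  have hsmall : Tendsto (fun ε => 16 * (√(b ε * (‖S₁ ε‖ / ε)) + b ε * BCoef φ κ ε (S ε))) l
      (𝓝 0) := by
    simpa using (hnorm.sqrt.add hB).const_mul 16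
  filter_upwards [hκ, hx, hgap, hlarge, hsmall.eventually_le_const one_pos,
    hnorm.eventually_le_const (by positivity : 0 < c / 4)] with ε hκε hxε hgapε hlargeε hsmallε hcε
  have hε := hκε.noise_pos
  set n := ‖S₁ ε‖ / ε
  have hn : 0 ≤ n := by positivity
  have hb : 0 < b ε := hκε.bound_nonneg.lt_of_ne fun hzero => by
    rw [← hzero, zero_mul] at hlargeε
    exact hn.not_gt hlargeε
  have hmul : b ε * √(n / b ε) = √(b ε * n) := by
    nth_rw 1 [← Real.sqrt_sq hb.le]
    rw [← Real.sqrt_mul (sq_nonneg _)]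
    congr 1
    field_simp
  have hroot : √(n / b ε) ≤ BCoef φ κ ε (S ε) - x ε := by
    rw [Real.sqrt_le_left hgapε, div_le_iff₀' hb]
    exact hlargeε.le
  have hlog := Real.log_le_log (typeII_pos hφ hε.ne' hxε (S ε))
    (hκε.typeII_le_exp hφ (Real.sqrt_nonneg _) hroot (by rwa [mul_add, hmul]))
  rw [Real.log_exp, Real.sq_sqrt (by positivity)] at hlog
  rw [Real.norm_of_nonneg (sq_nonneg n), Real.norm_of_nonneg neg_log_typeII_nonneg]
  calc n ^ 2 = 4 * (b ε * n) * (n / b ε / 4) := by field_simp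
    _ ≤ c * -Real.log (typeII φ κ ε (x ε) (S ε)) := by
        gcongr <;> linarith

/-- Either the gap is moderate and the Gaussian approximation applies to both signals, or the error
exponent is so large that shifting the signal by `S₁` does not affect it. -/
theorem neg_log_typeII_add_isEquivalent (hφ : Orthonormal ℝ φ)
    (hκ : ∀ᶠ ε in l, WeightBound κ ε (b ε)) (hx : ∀ᶠ ε in l, typeI φ κ ε (x ε) < 1)
    (hB : Tendsto (fun ε => b ε * BCoef φ κ ε (S ε)) l (𝓝 0))
    (hnorm : Tendsto (fun ε => b ε * (‖S₁ ε‖ / ε)) l (𝓝 0))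
    (hgap : Tendsto (fun ε => BCoef φ κ ε (S ε) - x ε) l atTop)
    (hS : (fun ε => BCoef φ κ ε (S ε)) =O[l] fun ε => BCoef φ κ ε (S ε) - x ε)
    (hS₁ : (fun ε => BCoef φ κ ε (S₁ ε)) =o[l] fun ε => BCoef φ κ ε (S ε) - x ε) :
    (fun ε => -Real.log (typeII φ κ ε (x ε) (S ε + S₁ ε))) ~[l]
      fun ε => -Real.log (typeII φ κ ε (x ε) (S ε)) := by
  set P : Set ℝ := {ε | b ε * (BCoef φ κ ε (S ε) - x ε) ^ 2 ≤ ‖S₁ ε‖ / ε}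
  have hP : l ⊓ 𝓟 P ≤ l := inf_le_left
  have hPc : l ⊓ 𝓟 Pᶜ ≤ l := inf_le_left
  have hbgap : Tendsto (fun ε => b ε * (BCoef φ κ ε (S ε) - x ε)) (l ⊓ 𝓟 P) (𝓝 0) := by
    refine squeeze_zero' (g := fun ε => √(b ε * (‖S₁ ε‖ / ε))) ?_ ?_
      (by simpa using (hnorm.mono_left hP).sqrt)
    · filter_upwards [hP hκ, hP (hgap.eventually_ge_atTop 0)] with ε hκε hgapε
      exact mul_nonneg hκε.bound_nonneg hgapε
    · filter_upwards [hP hκ, eventually_inf_principal.2 (.of_forall fun _ => id)] with ε hκε hε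
      refine Real.le_sqrt_of_sq_le ?_
      calc (b ε * (BCoef φ κ ε (S ε) - x ε)) ^ 2
          = b ε * (b ε * (BCoef φ κ ε (S ε) - x ε) ^ 2) := by ring
        _ ≤ b ε * (‖S₁ ε‖ / ε) := mul_le_mul_of_nonneg_left hε hκε.bound_nonneg
  have hmoderate := neg_log_typeII_add_isEquivalent_of_tendsto_mul_gap hφ (hP hκ)
    (hB.mono_left hP) (hgap.mono_left hP) (hS.mono hP) (hS₁.mono hP) hbgap
  have hlarge := neg_log_typeII_add_isEquivalent_of_norm_sq_isLittleO hφ (hPc hκ) (hPc hx)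
    (norm_sq_isLittleO_neg_log_typeII hφ (hPc hκ) (hPc hx) (hB.mono_left hPc)
      (hnorm.mono_left hPc) (hPc (hgap.eventually_ge_atTop 0))
      (eventually_inf_principal.2 (.of_forall fun ε hε => not_le.1 hε)))
  have hunion : l ⊓ 𝓟 P ⊔ l ⊓ 𝓟 Pᶜ = l := by
    rw [← inf_sup_left, sup_principal, Set.union_compl_self, principal_univ, inf_top_eq]
  exact hunion ▸ hmoderate.isLittleO.sup hlarge.isLittleO

end Comparison

theorem isBigO_of_eventually_mul_le {ι : Type*} {l : Filter ι} {f g : ι → ℝ} {c : ℝ}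
    (hc : 0 < c) (hf : 0 ≤ᶠ[l] f) (hfg : ∀ᶠ i in l, c * f i ≤ g i) : f =O[l] g := by
  refine IsBigO.of_bound c⁻¹ ?_
  filter_upwards [hf, hfg] with i hfi hfgi
  rw [Real.norm_of_nonneg hfi, le_inv_mul_iff₀ hc]
  exact hfgi.trans (Real.le_norm_self _)

theorem eventually_half_bCoef_le_gap {φ : ℕ → Signal} {κ : ℝ → ℕ → ℝ} (hφ : Orthonormal ℝ φ)
    {l : Filter ℝ} {b rate x : ℝ → ℝ} {S : ℝ → Signal} (hκ : ∀ᶠ ε in l, WeightBound κ ε (b ε))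
    (hrate : Tendsto rate l atTop) (hb : Tendsto (fun ε => b ε * rate ε) l (𝓝 0))
    (hx : IsTestFamily φ κ l x) (hlevel : LogLevelNegligible φ κ l rate x) {c : ℝ} (hc : 0 < c)
    (hBrate : ∀ᶠ ε in l, c * rate ε ≤ BCoef φ κ ε (S ε)) :
    ∀ᶠ ε in l, 1 / 2 * BCoef φ κ ε (S ε) ≤ BCoef φ κ ε (S ε) - x ε := by
  filter_upwards [hBrate,
    eventually_le_mul_rate_of_logLevelNegligible hφ hκ hrate hb hx hlevel (half_pos hc)]
    with ε hBε hxε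
  linarith

section WeightConditions

variable {κ : ℝ → ℕ → ℝ} {ε r ω : ℝ}

theorem kIndex_mul_kSq_sq_le (hanti : Antitone fun i => κ ε i ^ 2) (hε : ε ≠ 0)
    (hA : ACoef κ ε ≠ 0) : kIndex κ ε * kSq κ ε ^ 2 ≤ ACoef κ ε * ε ^ 4 := by
  have hterm : ∀ i ∈ Finset.range (kIndex κ ε), kSq κ ε ^ 2 ≤ κ ε i ^ 4 := fun i hi => by
    have hle : kSq κ ε ≤ κ ε i ^ 2 := hanti (Nat.le_sub_one_of_lt (Finset.mem_range.1 hi))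
    exact (pow_le_pow_left₀ (sq_nonneg _) hle 2).trans_eq (pow_mul ..).symm
  calc kIndex κ ε * kSq κ ε ^ 2 ≤ ∑ i ∈ Finset.range (kIndex κ ε), κ ε i ^ 4 := by
        simpa using Finset.card_nsmul_le_sum _ _ _ hterm
    _ ≤ ∑' i, κ ε i ^ 4 :=
        (summable_pow_four_of_aCoef_ne_zero hA).sum_le_tsum _ fun i _ => by positivity
    _ = ACoef κ ε * ε ^ 4 := by
        rw [ACoef]
        field_simp

theorem kSq_isBigO (hκ : WeightConditions κ)
    (hk : (fun ε : ℝ => ε ^ (-4 + 8 * r + 4 * ω)) =O[𝓝[>] 0] fun ε => (kIndex κ ε : ℝ)) :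
    kSq κ =O[𝓝[>] 0] fun ε => ε ^ (4 - 4 * r - 2 * ω) := by
  obtain ⟨C₁, hC₁, C₂, hA⟩ := hκ.A2
  obtain ⟨K, hK, hkK⟩ := hk.exists_pos
  refine IsBigO.of_pow two_ne_zero (.of_bound (K * C₂) ?_)
  filter_upwards [hkK.bound, self_mem_nhdsWithin] with ε hkε (hε : 0 < ε)
  have hpow : 0 < ε ^ (-4 + 8 * r + 4 * ω) := Real.rpow_pos_of_pos hε _
  have hscale : (ε ^ (4 - 4 * r - 2 * ω)) ^ 2 * ε ^ (-4 + 8 * r + 4 * ω) = ε ^ 4 := by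
    rw [← Real.rpow_mul_natCast hε.le, ← Real.rpow_add hε, ← Real.rpow_natCast]
    congr 1
    push_cast
    ring
  rw [Real.norm_of_nonneg hpow.le, Real.norm_of_nonneg (Nat.cast_nonneg _)] at hkε
  simp only [Pi.pow_apply, norm_pow, Real.norm_eq_abs, sq_abs]
  refine le_of_mul_le_mul_right ?_ hpow
  calc kSq κ ε ^ 2 * ε ^ (-4 + 8 * r + 4 * ω) ≤ kSq κ ε ^ 2 * (K * kIndex κ ε) :=
        mul_le_mul_of_nonneg_left hkε (sq_nonneg _)
    _ = K * (kIndex κ ε * kSq κ ε ^ 2) := by ring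
    _ ≤ K * (ACoef κ ε * ε ^ 4) := mul_le_mul_of_nonneg_left
        (kIndex_mul_kSq_sq_le (hκ.A1 ε hε) hε.ne' (hC₁.trans (hA ε hε).1).ne') hK.le
    _ ≤ K * (C₂ * ε ^ 4) := by
        gcongr
        exact (hA ε hε).2.le
    _ = K * C₂ * (ε ^ (4 - 4 * r - 2 * ω)) ^ 2 * ε ^ (-4 + 8 * r + 4 * ω) := by
        rw [mul_assoc (K * C₂), hscale, mul_assoc]

theorem exists_eventually_weightBound (hκ : WeightConditions κ)
    (hk : (fun ε : ℝ => ε ^ (-4 + 8 * r + 4 * ω)) =O[𝓝[>] 0] fun ε => (kIndex κ ε : ℝ)) :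
    ∃ K, ∀ᶠ ε in 𝓝[>] 0, WeightBound κ ε (K * ε ^ (2 - 4 * r - 2 * ω)) := by
  obtain ⟨C₁, hC₁, C₂, hA⟩ := hκ.A2
  obtain ⟨K, hK, hfirst⟩ := (hκ.A4_first.1.trans (kSq_isBigO hκ hk)).exists_pos
  refine ⟨K / √(2 * C₁), ?_⟩
  filter_upwards [hfirst.bound, self_mem_nhdsWithin] with ε hfirstε (hε : 0 < ε)
  refine ⟨hε, hκ.summable ε hε, hC₁.trans (hA ε hε).1, fun i => ?_⟩
  have hexp : ε ^ (4 - 4 * r - 2 * ω) = ε ^ (2 - 4 * r - 2 * ω) * ε ^ 2 := by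
    rw [← Real.rpow_natCast, ← Real.rpow_add hε]
    congr 1
    push_cast
    ring
  rw [kSqAt, Real.norm_of_nonneg (sq_nonneg _), Real.norm_of_nonneg (by positivity), hexp]
    at hfirstε
  have hsqrt : √(2 * C₁) ≤ √(2 * ACoef κ ε) := Real.sqrt_le_sqrt (by linarith [(hA ε hε).1])
  calc κ ε i ^ 2 ≤ κ ε 0 ^ 2 := hκ.A1 ε hε (Nat.zero_le i)
    _ ≤ K * (ε ^ (2 - 4 * r - 2 * ω) * ε ^ 2) := hfirstε
    _ = K / √(2 * C₁) * ε ^ (2 - 4 * r - 2 * ω) * (ε ^ 2 * √(2 * C₁)) := by field_simp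
    _ ≤ K / √(2 * C₁) * ε ^ (2 - 4 * r - 2 * ω) * (ε ^ 2 * √(2 * ACoef κ ε)) := by gcongr

end WeightConditions

section PowerScale

theorem tendsto_rpow_nhdsGT_zero {a : ℝ} (ha : 0 < a) :
    Tendsto (fun ε : ℝ => ε ^ a) (𝓝[>] 0) (𝓝 0) := by
  have hcont := (Real.continuousAt_rpow_const 0 a (.inr ha.le)).tendsto
  rw [Real.zero_rpow ha.ne'] at hcont
  exact hcont.mono_left nhdsWithin_le_nhds

theorem tendsto_mul_rpow_mul_nhds_zero {f : ℝ → ℝ} {a b : ℝ} (K : ℝ)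
    (hf : f =O[𝓝[>] 0] fun ε => ε ^ b) (hab : 0 < a + b) :
    Tendsto (fun ε => K * ε ^ a * f ε) (𝓝[>] 0) (𝓝 0) := by
  refine (((isBigO_refl (fun ε : ℝ => ε ^ a) _).const_mul_left K).mul hf).trans_tendsto
    ((tendsto_rpow_nhdsGT_zero hab).congr' ?_)
  filter_upwards [self_mem_nhdsWithin] with ε hε
  exact Real.rpow_add hε a b

theorem isBigO_div_rpow {f : ℝ → ℝ} {a : ℝ} (hf : f =O[𝓝[>] 0] fun ε => ε ^ a) :
    (fun ε => f ε / ε) =O[𝓝[>] 0] fun ε => ε ^ (a - 1) := by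
  refine (hf.mul (isBigO_refl (fun ε : ℝ => ε⁻¹) _)).congr' (.of_forall fun ε => ?_) ?_
  · exact (div_eq_mul_inv _ _).symm
  · filter_upwards [self_mem_nhdsWithin] with ε hε
    rw [Real.rpow_sub_one (ne_of_gt hε), div_eq_mul_inv]

end PowerScale

end SignalDetection

open SignalDetection in
theorem mainTheorem8_general {φ : ℕ → Signal} (hφ : Orthonormal ℝ φ) {κ : ℝ → ℕ → ℝ}
    {b rate : ℝ → ℝ} (hκ : ∀ᶠ ε in 𝓝[>] 0, WeightBound κ ε (b ε))
    (hrate : Tendsto rate (𝓝[>] 0) atTop)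
    (hb : Tendsto (fun ε => b ε * rate ε) (𝓝[>] 0) (𝓝 0)) {S S₁ : ℝ → Signal}
    (hS : Tendsto (fun ε => b ε * (‖S ε‖ / ε)) (𝓝[>] 0) (𝓝 0))
    (hS₁ : Tendsto (fun ε => b ε * (‖S₁ ε‖ / ε)) (𝓝[>] 0) (𝓝 0))
    (hcons : LDConsistent φ κ rate S) (hincons : LDInconsistent φ κ rate S₁)
    {x : ℝ → ℝ} (hx : IsTestFamily φ κ (𝓝[>] 0) x)
    (hx' : LogLevelNegligible φ κ (𝓝[>] 0) rate x ∨
      ∃ c > 0, ∀ᶠ ε in 𝓝[>] (0 : ℝ), c * BCoef φ κ ε (S ε) ≤ BCoef φ κ ε (S ε) - x ε) :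
    Tendsto
      (fun ε : ℝ =>
        (Real.log (typeII φ κ ε (x ε) (S ε)) - Real.log (typeII φ κ ε (x ε) (S ε + S₁ ε))) /
          Real.log (typeII φ κ ε (x ε) (S ε)))
      (𝓝[>] 0) (𝓝 0) := by
  have hB := tendsto_mul_bCoef hφ hκ hS
  obtain ⟨c, hc, hBrate⟩ :=
    eventually_rate_le_bCoef_of_ldConsistentAlong hφ hκ hrate hb hB hcons
  have hgapB : ∃ d > 0, ∀ᶠ ε in 𝓝[>] (0 : ℝ),
      d * BCoef φ κ ε (S ε) ≤ BCoef φ κ ε (S ε) - x ε :=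
    hx'.elim (fun h => ⟨1 / 2, one_half_pos,
      eventually_half_bCoef_le_gap hφ hκ hrate hb hx h hc hBrate⟩) id
  obtain ⟨d, hd, hgapB⟩ := hgapB
  have hrateB : rate =O[𝓝[>] 0] fun ε => BCoef φ κ ε (S ε) :=
    isBigO_of_eventually_mul_le hc (hrate.eventually_ge_atTop 0) hBrate
  have hBgap : (fun ε => BCoef φ κ ε (S ε)) =O[𝓝[>] 0] fun ε => BCoef φ κ ε (S ε) - x ε :=
    isBigO_of_eventually_mul_le hd (.of_forall fun ε => bCoef_nonneg φ κ ε _) hgapB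
  have hBtop : Tendsto (fun ε => d * BCoef φ κ ε (S ε)) (𝓝[>] 0) atTop :=
    (tendsto_atTop_mono' _ hBrate (hrate.const_mul_atTop hc)).const_mul_atTop hd
  have hS₁o := (bCoef_isLittleO_of_ldInconsistent hφ hκ hrate hb
    (tendsto_mul_bCoef hφ hκ hS₁) hincons).trans_isBigO (hrateB.trans hBgap)
  have hequiv := neg_log_typeII_add_isEquivalent hφ hκ (hx.mono fun _ => And.right) hB hS₁
    (tendsto_atTop_mono' _ hgapB hBtop) hBgap hS₁o
  refine (neg_zero (G := ℝ) ▸ hequiv.isLittleO.tendsto_div_nhds_zero.neg).congr fun ε => ?_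
  rw [Pi.sub_apply, ← div_neg, neg_neg, neg_sub_neg]

open SignalDetection in
theorem mainTheorem8
    (φ : ℕ → Signal) (hφ : Orthonormal ℝ φ)
    (κ : ℝ → ℕ → ℝ) (hκ : WeightConditions κ)
    (r ω : ℝ) (hr : 0 < r) (hr' : r < 1 / 2) (hω : 0 < 2 * ω) (hω' : 2 * ω < 1 - 2 * r)
    (hk : (fun ε : ℝ => (kIndex κ ε : ℝ)) =Θ[𝓝[>] 0] fun ε : ℝ => ε ^ (-4 + 8 * r + 4 * ω))
    (S S₁ : ℝ → Signal)
    (hS : (fun ε : ℝ => ‖S ε‖) =Θ[𝓝[>] 0] fun ε : ℝ => ε ^ (2 * r))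
    (hS₁ : (fun ε : ℝ => ‖S₁ ε‖) =Θ[𝓝[>] 0] fun ε : ℝ => ε ^ (2 * r))
    (hcons : LDConsistent φ κ (fun ε : ℝ => ε ^ (-2 * ω)) S)
    (hincons : LDInconsistent φ κ (fun ε : ℝ => ε ^ (-2 * ω)) S₁)
    (x : ℝ → ℝ) (hx : IsTestFamily φ κ (𝓝[>] 0) x)
    (hx' : LogLevelNegligible φ κ (𝓝[>] 0) (fun ε : ℝ => ε ^ (-2 * ω)) x ∨
      ∃ c > 0, ∀ᶠ ε in 𝓝[>] (0 : ℝ),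
        c * BCoef φ κ ε (S ε) ≤ BCoef φ κ ε (S ε) - x ε) :
    Tendsto
      (fun ε : ℝ =>
        (Real.log (typeII φ κ ε (x ε) (S ε)) - Real.log (typeII φ κ ε (x ε) (S ε + S₁ ε))) /
          Real.log (typeII φ κ ε (x ε) (S ε)))
      (𝓝[>] 0) (𝓝 0) := by
  obtain ⟨K, hweight⟩ := exists_eventually_weightBound hκ hk.2
  have hrate : Tendsto (fun ε : ℝ => ε ^ (-2 * ω)) (𝓝[>] 0) atTop :=
    tendsto_rpow_neg_nhdsGT_zero (by linarith)
  have hbound : ∀ {f : ℝ → ℝ} {a : ℝ}, f =O[𝓝[>] 0] (fun ε => ε ^ a) →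
      0 < 2 - 4 * r - 2 * ω + a →
      Tendsto (fun ε => K * ε ^ (2 - 4 * r - 2 * ω) * f ε) (𝓝[>] 0) (𝓝 0) :=
    tendsto_mul_rpow_mul_nhds_zero K
  exact mainTheorem8_general hφ hweight hrate (hbound (isBigO_refl _ _) (by linarith))
    (hbound (isBigO_div_rpow hS.1) (by linarith)) (hbound (isBigO_div_rpow hS₁.1) (by linarith))
    hcons hincons hx hx'
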